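/- Let $d\in\mathbf N$ and $t\ge s>1$. For multi-indices write $|\alpha|=\alpha_1+\dots+\alpha_d$, $\alpha!=\alpha_1!\cdots\alpha_d!$. Let $\Sigma_t^s(\mathbf R^d)$ be the space of all $f\in C^\infty(\mathbf R^d)$ such that for every $h>0$ $$\|f\|_h=\sup_{\alpha,\beta\in\mathbf N^d,\ x\in\mathbf R^d}\frac{|x^\alpha D^\beta f(x)|}{h^{|\alpha+\beta|}\,\alpha!^{t}\,\beta!^{s}}<\infty ,$$ with the Fréchet space topology defined by the norms $\|\cdot\|_h$, $h>0$, and let $(\Sigma_t^s)'(\mathbf R^d)$ be its topological dual; $\langle u,f\rangle$ denotes the bilinear pairing. For $\psi\in\Sigma_t^s(\mathbf R^d)\setminus 0$ and $u\in(\Sigma_t^s)'(\mathbf R^d)$ let $$V_\psi u(x,\xi)=(2\pi)^{-d/2}\,\big\langle u,\ \overline{\psi(\cdot-x)}\,e^{-i\langle\cdot,\xi\rangle}\big\rangle,\qquad x,\xi\in\mathbf R^d .$$ The set $\mathrm{WF}^{t,s}(u)\subseteq\mathbf R^{2d}\setminus 0$ is defined as follows: $(x_0,\xi_0)\in\mathbf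 R^{2d}\setminus0$ satisfies $(x_0,\xi_0)\notin\mathrm{WF}^{t,s}(u)$ if there is an open set $U\subseteq\mathbf R^{2d}\setminus 0$ containing $(x_0,\xi_0)$ such that $$\sup_{\lambda>0,\ (x,\xi)\in U}e^{r\lambda}\,|V_\psi u(\lambda^t x,\lambda^s\xi)|<\infty\qquad\text{for all } r>0 .$$ Let $G_c^s(\mathbf R^d)$ be the space of compactly supported $\varphi\in C^\infty(\mathbf R^d)$ such that for every $h>0$ there is $C>0$ with $|\partial^\alpha\varphi(x)|\le C\,h^{|\alpha|}\alpha!^s$ for all $x\in\mathbf R^d$, $\alpha\in\mathbf N^d$. Then $G_c^s(\mathbf R^d)\subseteq\Sigma_t^s(\mathbf R^d)$, and by restriction to $G_c^s(\mathbf R^d)$ each $u\in(\Sigma_t^s)'(\mathbf R^d)$ is a Gevrey ultradistribution of order $s$. For $\varphi\in G_c^s(\mathbf R^d)$ let $\widehat{u\varphi}(\xi)=(2\pi)^{-d/2}\langle u,\varphi\, e^{-i\langle\cdot,\xi\rangle}\rangle$. The Gevrey wave front set $\mathrm{WF}_s(u)\subseteq\mathbf R^d\times(\mathbf R^d\setminus0)$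 is defined as follows: $(x_0,\xi_0)\in\mathbf R^d\times(\mathbf R^d\setminus0)$ satisfies $(x_0,\xi_0)\notin\mathrm{WF}_s(u)$ if there are $\varphi\in G_c^s(\mathbf R^d)$ with $\varphi(x_0)=1$ and an open conic set $\Gamma\subseteq\mathbf R^d\setminus 0$ containing $\xi_0$ such that $$\sup_{\xi\in\Gamma}e^{r|\xi|^{1/s}}\,|\widehat{u\varphi}(\xi)|<\infty\qquad\text{for all } r>0 .$$ Finally let $\pi_2(x,\xi)=\xi$. Then for every $u\in(\Sigma_t^s)'(\mathbf R^d)$, $$\{0\}\times\pi_2\,\mathrm{WF}_s(u)\subseteq\mathrm{WF}^{t,s}(u),$$ whichever window $\psi\in\Sigma_t^s(\mathbf R^d)\setminus 0$ is used to define $\mathrm{WF}^{t,s}(u)$. -/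

import Mathlib

open scoped ContDiff Nat

namespace GelfandShilovWF

/-- The Euclidean space `ℝ^d`. -/
abbrev E (d : ℕ) : Type := EuclideanSpace ℝ (Fin d)

/-- The partial derivative `∂_j f`. -/
noncomputable def pderiv {d : ℕ} (j : Fin d) (f : E d → ℂ) : E d → ℂ :=
  fun x => fderiv ℝ f x (EuclideanSpace.single j 1)

/-- The partial derivative `∂^β f = ∂_0^{β_0} ⋯ ∂_{d-1}^{β_{d-1}} f` of a multi-index `β ∈ ℕ^d`. -/
noncomputable def mderiv {d : ℕ} (β : Fin d → ℕ) (f : E d → ℂ) : E d → ℂ :=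
  (List.finRange d).foldr (fun j g => (pderiv j)^[β j] g) f

/-- The length `|α| = α_0 + ⋯ + α_{d-1}`. -/
def mlen {d : ℕ} (α : Fin d → ℕ) : ℕ := ∑ j, α j

/-- The factorial `α! = α_0! ⋯ α_{d-1}!`. -/
def mfact {d : ℕ} (α : Fin d → ℕ) : ℕ := ∏ j, (α j)!

/-- The monomial `x^α`. -/
noncomputable def mpow {d : ℕ} (x : E d) (α : Fin d → ℕ) : ℝ := ∏ j, x j ^ α j

/-! ### Multi-indices and iterated Fréchet derivatives -/

/-- The list of directions of differentiation in `∂^β`. -/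
def dirs {d : ℕ} (β : Fin d → ℕ) : List (Fin d) :=
  (List.finRange d).flatMap (fun j => List.replicate (β j) j)

theorem mderiv_eq_foldr {d : ℕ} (β : Fin d → ℕ) (f : E d → ℂ) :
    mderiv β f = (dirs β).foldr pderiv f := by
  have key : ∀ l : List (Fin d), l.foldr (fun j g => (pderiv j)^[β j] g) f =
      (l.flatMap (fun j => List.replicate (β j) j)).foldr pderiv f := by
    intro l
    induction l with
    | nil => rfl
    | cons j l ih =>
      have h2 : ∀ (n : ℕ) (g : E d → ℂ),
          (List.replicate n j).foldr pderiv g = (pderiv j)^[n] g := by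
        intro n g
        induction n with
        | zero => rfl
        | succ n ih => rw [List.replicate_succ, List.foldr_cons, ih, Function.iterate_succ_apply']
      rw [List.foldr_cons, List.flatMap_cons, List.foldr_append, ← ih, h2]
  exact key _

theorem contDiff_pderiv {d : ℕ} (j : Fin d) {f : E d → ℂ} (hf : ContDiff ℝ ∞ f) :
    ContDiff ℝ ∞ (pderiv j f) :=
  (hf.fderiv_right (m := ∞) (by simp)).clm_apply contDiff_const

theorem contDiff_foldr {d : ℕ} (l : List (Fin d)) {f : E d → ℂ} (hf : ContDiff ℝ ∞ f) :
    ContDiff ℝ ∞ (l.foldr pderiv f) := by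
  induction l with
  | nil => exact hf
  | cons j l ih => exact contDiff_pderiv j ih

theorem contDiff_mderiv {d : ℕ} (β : Fin d → ℕ) {f : E d → ℂ} (hf : ContDiff ℝ ∞ f) :
    ContDiff ℝ ∞ (mderiv β f) := by
  rw [mderiv_eq_foldr]; exact contDiff_foldr _ hf

theorem pderiv_comm {d : ℕ} (i j : Fin d) {f : E d → ℂ} (hf : ContDiff ℝ ∞ f) :
    pderiv i (pderiv j f) = pderiv j (pderiv i f) := by
  have hd : Differentiable ℝ (fderiv ℝ f) :=
    (hf.fderiv_right (m := ∞) (by simp)).differentiable (by simp)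
  have h : ∀ (i j : Fin d) (x : E d), pderiv i (pderiv j f) x =
      fderiv ℝ (fderiv ℝ f) x (EuclideanSpace.single i 1) (EuclideanSpace.single j 1) := by
    intro i j x
    change fderiv ℝ (fun y => fderiv ℝ f y (EuclideanSpace.single j 1)) x _ = _
    rw [fderiv_clm_apply (hd x) (differentiableAt_const _)]
    simp
  funext x
  rw [h, h]
  have hs : IsSymmSndFDerivAt ℝ f x :=
    hf.contDiffAt.isSymmSndFDerivAt (by simpa using (WithTop.coe_le_coe.mpr (le_top : (2 : ℕ∞) ≤ ⊤) : (2 : WithTop ℕ∞) ≤ ∞))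
  exact hs _ _

theorem foldr_perm {d : ℕ} {l l' : List (Fin d)} (h : l.Perm l') {f : E d → ℂ}
    (hf : ContDiff ℝ ∞ f) : l.foldr pderiv f = l'.foldr pderiv f := by
  induction h with
  | nil => rfl
  | cons j _ ih => simp only [List.foldr_cons, ih]
  | swap i j l => exact pderiv_comm _ _ (contDiff_foldr l hf)
  | trans _ _ ih1 ih2 => exact ih1.trans ih2

theorem iteratedFDeriv_basis {d : ℕ} {f : E d → ℂ} (hf : ContDiff ℝ ∞ f) (n : ℕ)
    (j : Fin n → Fin d) (x : E d) :
    iteratedFDeriv ℝ n f x (fun i => EuclideanSpace.single (j i) (1 : ℝ)) =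
      (List.ofFn j).foldr pderiv f x := by
  induction n generalizing x with
  | zero => simp
  | succ n ih =>
    rw [iteratedFDeriv_succ_apply_left, List.ofFn_succ, List.foldr_cons]
    have h1 : (List.ofFn fun i : Fin n => j i.succ).foldr pderiv f =
        fun y => iteratedFDeriv ℝ n f y (fun i => EuclideanSpace.single (j i.succ) (1 : ℝ)) := by
      funext y; exact (ih (fun i => j i.succ) y).symm
    rw [h1]
    have hd : DifferentiableAt ℝ (iteratedFDeriv ℝ n f) x :=
      (hf.differentiable_iteratedFDeriv (by exact_mod_cast ENat.natCast_lt_top n)) x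
    change _ = fderiv ℝ (fun y => iteratedFDeriv ℝ n f y _) x (EuclideanSpace.single (j 0) 1)
    have := (hd.hasFDerivAt.continuousMultilinear_apply_const
      (fun i => EuclideanSpace.single (j i.succ) (1 : ℝ))).fderiv
    rw [this]
    rfl

theorem count_dirs {d : ℕ} (β : Fin d → ℕ) (j : Fin d) : (dirs β).count j = β j := by
  unfold dirs
  rw [List.count_flatMap]
  have : (List.map (List.count j ∘ fun k => List.replicate (β k) k) (List.finRange d)) =
      List.map (fun k => if k = j then β k else 0) (List.finRange d) := by
    apply List.map_congr_left
    intro k _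
    simp [List.count_replicate]
  rw [this, ← List.ofFn_eq_map, List.sum_ofFn]
  simp

theorem length_dirs {d : ℕ} (β : Fin d → ℕ) : (dirs β).length = mlen β := by
  unfold dirs mlen
  rw [List.length_flatMap]
  simp only [List.length_replicate]
  rw [← List.ofFn_eq_map, List.sum_ofFn]

theorem norm_mderiv_le {d : ℕ} {f : E d → ℂ} (hf : ContDiff ℝ ∞ f) (β : Fin d → ℕ) (x : E d) :
    ‖mderiv β f x‖ ≤ ‖iteratedFDeriv ℝ (mlen β) f x‖ := by
  have h := iteratedFDeriv_basis hf (dirs β).length (fun i => (dirs β).get i) x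
  rw [List.ofFn_get, ← mderiv_eq_foldr] at h
  rw [← h, ← length_dirs]
  refine (ContinuousMultilinearMap.le_opNorm _ _).trans ?_
  simp

theorem norm_iteratedFDeriv_le {d : ℕ} {f : E d → ℂ} (hf : ContDiff ℝ ∞ f) (n : ℕ) (x : E d)
    {B : ℝ} (hB0 : 0 ≤ B) (hB : ∀ β : Fin d → ℕ, mlen β = n → ‖mderiv β f x‖ ≤ B) :
    ‖iteratedFDeriv ℝ n f x‖ ≤ (d : ℝ) ^ n * B := by
  refine ContinuousMultilinearMap.opNorm_le_bound (by positivity) ?_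
  intro m
  have hm : m = fun i => ∑ k : Fin d, (m i k) • (EuclideanSpace.single k (1 : ℝ) : E d) := by
    funext i
    ext k
    simp [Finset.sum_apply, Pi.single_apply]
  have hbound : ∀ j : Fin n → Fin d,
      ‖iteratedFDeriv ℝ n f x (fun i => (m i (j i)) • (EuclideanSpace.single (j i) (1 : ℝ) : E d))‖
        ≤ (∏ i, ‖m i‖) * B := by
    intro j
    rw [ContinuousMultilinearMap.map_smul_univ, norm_smul, norm_prod]
    refine mul_le_mul ?_ ?_ (norm_nonneg _) (by positivity)
    · exact Finset.prod_le_prod (fun _ _ => norm_nonneg _) fun i _ => PiLp.norm_apply_le _ _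
    · rw [iteratedFDeriv_basis hf]
      have hp : (List.ofFn j).Perm (dirs fun k => (List.ofFn j).count k) := by
        rw [List.perm_iff_count]
        intro k
        rw [count_dirs]
      rw [foldr_perm hp hf, ← mderiv_eq_foldr]
      apply hB
      rw [← length_dirs, ← hp.length_eq, List.length_ofFn]
  calc ‖iteratedFDeriv ℝ n f x m‖
      = ‖∑ j : Fin n → Fin d, iteratedFDeriv ℝ n f x
          (fun i => (m i (j i)) • (EuclideanSpace.single (j i) (1 : ℝ) : E d))‖ := by
        conv_lhs => rw [hm]
        rw [ContinuousMultilinearMap.map_sum]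
    _ ≤ ∑ j : Fin n → Fin d, (∏ i, ‖m i‖) * B :=
        norm_sum_le_of_le _ fun j _ => hbound j
    _ = (d : ℝ) ^ n * B * ∏ i, ‖m i‖ := by
        simp; ring


/-! ### Elementary estimates -/

theorem exists_pow_le {t : ℝ} (ht : 0 < t) (R : ℝ) (hR : 0 ≤ R) {k : ℝ} (hk : 0 < k) :
    ∃ C : ℝ, 1 ≤ C ∧ ∀ n : ℕ, R ^ n ≤ C * (k ^ n * (n ! : ℝ) ^ t) := by
  refine ⟨Real.exp ((R / k) ^ (1 / t)) ^ t, Real.one_le_rpow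
    (Real.one_le_exp (by positivity)) ht.le, fun n => ?_⟩
  have h1 := Real.pow_div_factorial_le_exp (x := (R / k) ^ (1 / t)) (by positivity) n
  have h2 : (((R / k) ^ (1 / t)) ^ n / (n ! : ℝ)) ^ t ≤ Real.exp ((R / k) ^ (1 / t)) ^ t :=
    Real.rpow_le_rpow (by positivity) h1 ht.le
  rw [Real.div_rpow (by positivity) (by positivity), ← Real.rpow_natCast, ← Real.rpow_mul
    (by positivity), ← Real.rpow_mul (by positivity)] at h2
  have h3 : 1 / t * ((n : ℝ) * t) = n := by field_simp
  rw [h3, Real.rpow_natCast, div_pow, div_le_iff₀ (by positivity),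
    div_le_iff₀ (by positivity)] at h2
  linarith

theorem mfact_pos {d : ℕ} (α : Fin d → ℕ) : (0 : ℝ) < mfact α := by
  unfold mfact
  exact_mod_cast Finset.prod_pos fun j _ => Nat.factorial_pos _

theorem mfact_le {d : ℕ} (α : Fin d → ℕ) : (mfact α : ℝ) ≤ ((mlen α)! : ℝ) := by
  unfold mfact mlen
  exact_mod_cast Nat.le_of_dvd (Nat.factorial_pos _) (Nat.prod_factorial_dvd_factorial_sum _ _)

theorem factorial_mlen_le {d : ℕ} (α : Fin d → ℕ) :
    ((mlen α)! : ℝ) ≤ ((d : ℝ) + 1) ^ mlen α * mfact α := by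
  have h1 := Nat.multinomial_spec Finset.univ α
  have h2 : Nat.multinomial Finset.univ α ≤ d ^ mlen α := by
    have h := Finset.sum_pow_eq_sum_piAntidiag (R := ℕ) (Finset.univ : Finset (Fin d))
      (fun _ => 1) (mlen α)
    simp only [Finset.sum_const, Finset.card_univ, Fintype.card_fin, smul_eq_mul, mul_one,
      one_pow, Finset.prod_const_one] at h
    rw [h]
    refine Finset.single_le_sum (f := fun k => Nat.multinomial Finset.univ k)
      (fun _ _ => Nat.zero_le _) ?_
    simp [mlen]
  have h3 : (mlen α)! ≤ (d + 1) ^ mlen α * mfact α := by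
    unfold mlen mfact at *
    rw [← h1, mul_comm]
    exact Nat.mul_le_mul_right _ (h2.trans (Nat.pow_le_pow_left (Nat.le_succ d) _))
  exact_mod_cast h3

theorem norm_le_of_multi {d : ℕ} {s : ℝ} (hs : 0 ≤ s) {f : E d → ℂ} (hf : ContDiff ℝ ∞ f)
    {W A k : ℝ} (hW : 0 ≤ W) (hA : 0 ≤ A) (hk : 0 < k) {x : E d}
    (h : ∀ β, W * ‖mderiv β f x‖ ≤ A * (k ^ mlen β * (mfact β : ℝ) ^ s)) (n : ℕ) :
    W * ‖iteratedFDeriv ℝ n f x‖ ≤ A * ((((d : ℝ) + 1) * k) ^ n * (n ! : ℝ) ^ s) := by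
  rcases hW.eq_or_lt with rfl | hW
  · rw [zero_mul]; positivity
  have h1 := norm_iteratedFDeriv_le hf n x (B := A * (k ^ n * (n ! : ℝ) ^ s) / W)
    (by positivity) (by
      intro β hβ
      rw [le_div_iff₀ hW, mul_comm]
      refine (h β).trans ?_
      rw [hβ]
      gcongr
      rw [← hβ]; exact_mod_cast mfact_le β)
  have h2 : W * ‖iteratedFDeriv ℝ n f x‖ ≤ (d : ℝ) ^ n * (A * (k ^ n * (n ! : ℝ) ^ s)) := by
    calc W * ‖iteratedFDeriv ℝ n f x‖
        ≤ W * ((d : ℝ) ^ n * (A * (k ^ n * (n ! : ℝ) ^ s) / W)) := by gcongr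
      _ = _ := by field_simp
  refine h2.trans ?_
  rw [mul_pow]
  have : (d : ℝ) ^ n ≤ ((d : ℝ) + 1) ^ n := by gcongr; linarith
  calc (d : ℝ) ^ n * (A * (k ^ n * (n ! : ℝ) ^ s))
      ≤ ((d : ℝ) + 1) ^ n * (A * (k ^ n * (n ! : ℝ) ^ s)) := by gcongr
    _ = _ := by ring

theorem multi_le_of_norm {d : ℕ} {s : ℝ} (hs : 0 ≤ s) {f : E d → ℂ} (hf : ContDiff ℝ ∞ f)
    {W A k : ℝ} (hW : 0 ≤ W) (hA : 0 ≤ A) (hk : 0 < k) {x : E d}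
    (h : ∀ n, W * ‖iteratedFDeriv ℝ n f x‖ ≤ A * (k ^ n * (n ! : ℝ) ^ s)) (β : Fin d → ℕ) :
    W * ‖mderiv β f x‖ ≤ A * ((((d : ℝ) + 1) ^ s * k) ^ mlen β * (mfact β : ℝ) ^ s) := by
  calc W * ‖mderiv β f x‖ ≤ W * ‖iteratedFDeriv ℝ (mlen β) f x‖ := by
        gcongr; exact norm_mderiv_le hf β x
    _ ≤ A * (k ^ mlen β * ((mlen β)! : ℝ) ^ s) := h _
    _ ≤ A * (k ^ mlen β * (((d : ℝ) + 1) ^ mlen β * mfact β) ^ s) := by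
        gcongr; exact factorial_mlen_le β
    _ = _ := by
        rw [Real.mul_rpow (by positivity) (mfact_pos β).le, mul_pow,
          ← Real.rpow_natCast (((d : ℝ) + 1) ^ s), ← Real.rpow_natCast ((d : ℝ) + 1),
          ← Real.rpow_mul (by positivity), ← Real.rpow_mul (by positivity), mul_comm s]
        ring

/-! ### Modulation, translation and complex conjugation of functions -/

/-- Modulation `M_ξ f(y) = e^{i⟨y, ξ⟩} f(y)`. -/
noncomputable def modFun {d : ℕ} (ξ : E d) (f : E d → ℂ) : E d → ℂ :=
  fun y => Complex.exp (Complex.I * ((inner ℝ y ξ : ℝ) : ℂ)) * f y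

/-- Translation `T_a f(y) = f(y - a)`. -/
def transFun {d : ℕ} (a : E d) (f : E d → ℂ) : E d → ℂ := fun y => f (y - a)

/-- Complex conjugation of a function. -/
noncomputable def conjFun {d : ℕ} (f : E d → ℂ) : E d → ℂ := fun y => starRingEnd ℂ (f y)

theorem contDiff_character {d : ℕ} (ξ : E d) :
    ContDiff ℝ ∞ (fun y : E d => Complex.exp (Complex.I * ((inner ℝ y ξ : ℝ) : ℂ))) := by
  have h : ContDiff ℝ ∞ (fun y : E d => ((inner ℝ y ξ : ℝ) : ℂ)) :=
    Complex.ofRealCLM.contDiff.comp (contDiff_id.inner ℝ contDiff_const)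
  exact (contDiff_const.mul h).cexp

theorem norm_iteratedFDeriv_character {d : ℕ} (ξ : E d) (n : ℕ) (x : E d) :
    ‖iteratedFDeriv ℝ n (fun y : E d => Complex.exp (Complex.I * ((inner ℝ y ξ : ℝ) : ℂ))) x‖
      ≤ ‖ξ‖ ^ n := by
  have hg : ContDiff ℝ ∞ (fun r : ℝ => Complex.exp (Complex.I * (r : ℂ))) :=
    (contDiff_const.mul Complex.ofRealCLM.contDiff).cexp
  have h1 : (fun y : E d => Complex.exp (Complex.I * ((inner ℝ y ξ : ℝ) : ℂ))) =
      (fun r : ℝ => Complex.exp (Complex.I * (r : ℂ))) ∘ (innerSL ℝ ξ) := by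
    funext y; simp [real_inner_comm]
  have h2 : ∀ n : ℕ, iteratedDeriv n (fun r : ℝ => Complex.exp (Complex.I * (r : ℂ))) =
      fun r : ℝ => Complex.I ^ n * Complex.exp (Complex.I * (r : ℂ)) := by
    intro n
    induction n with
    | zero => simp
    | succ n ih =>
      rw [iteratedDeriv_succ, ih]
      funext r
      have : HasDerivAt (fun r : ℝ => Complex.I ^ n * Complex.exp (Complex.I * (r : ℂ)))
          (Complex.I ^ n * (Complex.exp (Complex.I * (r : ℂ)) * (Complex.I * 1))) r :=
        (((Complex.ofRealCLM.hasDerivAt (x := r)).const_mul Complex.I).cexp).const_mul _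
      rw [this.deriv]
      ring
  rw [h1, ContinuousLinearMap.iteratedFDeriv_comp_right (innerSL ℝ ξ) hg x
    (i := n) (by exact_mod_cast le_top)]
  refine (ContinuousMultilinearMap.norm_compContinuousLinearMap_le _ _).trans ?_
  rw [norm_iteratedFDeriv_eq_norm_iteratedDeriv, h2]
  simp [Complex.norm_exp]

theorem contDiff_modFun {d : ℕ} (ξ : E d) {f : E d → ℂ} (hf : ContDiff ℝ ∞ f) :
    ContDiff ℝ ∞ (modFun ξ f) := (contDiff_character ξ).mul hf

theorem norm_modFun_le {d : ℕ} {s : ℝ} (hs : 0 < s) (ξ : E d) {k : ℝ} (hk : 0 < k) :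
    ∃ C' : ℝ, 1 ≤ C' ∧ ∀ f : E d → ℂ, ContDiff ℝ ∞ f → ∀ W A : ℝ, 0 ≤ W → 0 ≤ A → ∀ x : E d,
      (∀ n, W * ‖iteratedFDeriv ℝ n f x‖ ≤ A * (k ^ n * (n ! : ℝ) ^ s)) →
      ∀ n, W * ‖iteratedFDeriv ℝ n (modFun ξ f) x‖ ≤ C' * A * ((2 * k) ^ n * (n ! : ℝ) ^ s) := by
  obtain ⟨C', hC1, hC⟩ := exists_pow_le hs ‖ξ‖ (norm_nonneg _) hk
  refine ⟨C', hC1, fun f hf W A hW hA x h n => ?_⟩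
  have hC0 : 0 ≤ C' := by linarith
  have h1 := norm_iteratedFDeriv_mul_le (contDiff_character ξ) hf x (n := n)
    (by exact_mod_cast le_top)
  calc W * ‖iteratedFDeriv ℝ n (modFun ξ f) x‖
      ≤ W * ∑ i ∈ Finset.range (n + 1), (n.choose i : ℝ) *
        ‖iteratedFDeriv ℝ i (fun y : E d => Complex.exp (Complex.I * ((inner ℝ y ξ : ℝ) : ℂ))) x‖ *
        ‖iteratedFDeriv ℝ (n - i) f x‖ := mul_le_mul_of_nonneg_left h1 hW
    _ ≤ ∑ i ∈ Finset.range (n + 1), (n.choose i : ℝ) * (C' * A * (k ^ n * (n ! : ℝ) ^ s)) := by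
        rw [Finset.mul_sum]
        refine Finset.sum_le_sum fun i hi => ?_
        have hin : i ≤ n := Nat.lt_succ_iff.mp (Finset.mem_range.mp hi)
        have e1 := (norm_iteratedFDeriv_character ξ i x).trans (hC i)
        have e2 := h (n - i)
        have e3 : (i ! : ℝ) ^ s * ((n - i)! : ℝ) ^ s ≤ (n ! : ℝ) ^ s := by
          rw [← Real.mul_rpow (by positivity) (by positivity)]
          refine Real.rpow_le_rpow (by positivity) ?_ hs.le
          exact_mod_cast Nat.le_of_dvd (Nat.factorial_pos _)
            (Nat.factorial_mul_factorial_dvd_factorial hin)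
        set a := ‖iteratedFDeriv ℝ i
          (fun y : E d => Complex.exp (Complex.I * ((inner ℝ y ξ : ℝ) : ℂ))) x‖
        set b := ‖iteratedFDeriv ℝ (n - i) f x‖
        have hkn : k ^ i * k ^ (n - i) = k ^ n := by rw [← pow_add]; congr 1; omega
        calc W * ((n.choose i : ℝ) * a * b) = (n.choose i : ℝ) * (a * (W * b)) := by ring
          _ ≤ (n.choose i : ℝ) * ((C' * (k ^ i * (i ! : ℝ) ^ s)) *
              (A * (k ^ (n - i) * ((n - i)! : ℝ) ^ s))) := by
              gcongr
          _ = (n.choose i : ℝ) * (C' * A * ((k ^ i * k ^ (n - i)) *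
              ((i ! : ℝ) ^ s * ((n - i)! : ℝ) ^ s))) := by ring
          _ ≤ _ := by rw [hkn]; gcongr
    _ = C' * A * ((2 * k) ^ n * (n ! : ℝ) ^ s) := by
        rw [← Finset.sum_mul]
        have : ∑ i ∈ Finset.range (n + 1), (n.choose i : ℝ) = 2 ^ n := by
          exact_mod_cast Nat.sum_range_choose n
        rw [this, mul_pow]; ring

/-- The multi-index form of the estimate for modulations. -/
theorem mderiv_modFun_le {d : ℕ} {s : ℝ} (hs : 0 < s) (ξ : E d) {h : ℝ} (hh : 0 < h) :
    ∃ C' k : ℝ, 1 ≤ C' ∧ 0 < k ∧ k ≤ h ∧ ∀ f : E d → ℂ, ContDiff ℝ ∞ f → ∀ W A : ℝ,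
      0 ≤ W → 0 ≤ A → ∀ x : E d,
      (∀ β, W * ‖mderiv β f x‖ ≤ A * (k ^ mlen β * (mfact β : ℝ) ^ s)) →
      ∀ β, W * ‖mderiv β (modFun ξ f) x‖ ≤ C' * A * (h ^ mlen β * (mfact β : ℝ) ^ s) := by
  set D : ℝ := (d : ℝ) + 1
  have hD1 : 1 ≤ D := by simp [D]
  have hDs : 1 ≤ D ^ s := Real.one_le_rpow hD1 hs.le
  set k : ℝ := h / (D ^ s * (2 * D)) with hk_def
  have hk : 0 < k := by positivity
  obtain ⟨C', hC1, hC⟩ := norm_modFun_le hs ξ (k := D * k) (by positivity)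
  refine ⟨C', k, hC1, hk, div_le_self hh.le (by nlinarith), fun f hf W A hW hA x hb β => ?_⟩
  have h1 := hC f hf W A hW hA x (norm_le_of_multi hs.le hf hW hA hk hb)
  have h2 := multi_le_of_norm hs.le (contDiff_modFun ξ hf) hW (by positivity) (by positivity) h1 β
  have h3 : D ^ s * (2 * (D * k)) = h := by rw [hk_def]; field_simp
  rwa [h3] at h2

theorem pderiv_transFun {d : ℕ} (a : E d) (j : Fin d) (f : E d → ℂ) :
    pderiv j (transFun a f) = transFun a (pderiv j f) := by
  funext x
  change fderiv ℝ (fun y => f (y - a)) x _ = fderiv ℝ f (x - a) _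
  rw [fderiv_comp_sub]

theorem mderiv_transFun {d : ℕ} (a : E d) (β : Fin d → ℕ) (f : E d → ℂ) :
    mderiv β (transFun a f) = transFun a (mderiv β f) := by
  rw [mderiv_eq_foldr, mderiv_eq_foldr]
  induction dirs β with
  | nil => rfl
  | cons j l ih => rw [List.foldr_cons, ih, pderiv_transFun]; rfl

theorem pderiv_conjFun {d : ℕ} (j : Fin d) (f : E d → ℂ) :
    pderiv j (conjFun f) = conjFun (pderiv j f) := by
  funext x
  change fderiv ℝ (Complex.conjCLE ∘ f) x _ = _
  rw [ContinuousLinearEquiv.comp_fderiv]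
  rfl

theorem mderiv_conjFun {d : ℕ} (β : Fin d → ℕ) (f : E d → ℂ) :
    mderiv β (conjFun f) = conjFun (mderiv β f) := by
  rw [mderiv_eq_foldr, mderiv_eq_foldr]
  induction dirs β with
  | nil => rfl
  | cons j l ih => rw [List.foldr_cons, ih, pderiv_conjFun]; rfl

theorem mderiv_add {d : ℕ} (β : Fin d → ℕ) {f g : E d → ℂ} (hf : ContDiff ℝ ∞ f)
    (hg : ContDiff ℝ ∞ g) : mderiv β (f + g) = mderiv β f + mderiv β g := by
  simp only [mderiv_eq_foldr]
  induction dirs β with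
  | nil => rfl
  | cons j l ih =>
    rw [List.foldr_cons, ih]
    funext x
    change fderiv ℝ (l.foldr pderiv f + l.foldr pderiv g) x _ = _
    rw [fderiv_add ((contDiff_foldr l hf).differentiable (by simp) x)
      ((contDiff_foldr l hg).differentiable (by simp) x)]
    rfl

theorem mderiv_smul {d : ℕ} (β : Fin d → ℕ) (c : ℂ) {f : E d → ℂ} (hf : ContDiff ℝ ∞ f) :
    mderiv β (c • f) = c • mderiv β f := by
  simp only [mderiv_eq_foldr]
  induction dirs β with
  | nil => rfl
  | cons j l ih =>
    rw [List.foldr_cons, ih]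
    funext x
    change fderiv ℝ (c • l.foldr pderiv f) x _ = _
    rw [fderiv_const_smul ((contDiff_foldr l hf).differentiable (by simp) x)]
    rfl

theorem mderiv_zero {d : ℕ} (β : Fin d → ℕ) : mderiv β (0 : E d → ℂ) = 0 := by
  have := mderiv_smul β (0 : ℂ) (f := (0 : E d → ℂ)) contDiff_const
  simpa using this

theorem mderiv_eq_zero_of_notMem {d : ℕ} (β : Fin d → ℕ) {f : E d → ℂ} (hf : ContDiff ℝ ∞ f)
    {x : E d} (hx : x ∉ tsupport f) : mderiv β f x = 0 := by
  have h1 := norm_mderiv_le hf β x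
  have h2 : iteratedFDeriv ℝ (mlen β) f x = 0 := by
    by_contra h
    exact hx (support_iteratedFDeriv_subset (𝕜 := ℝ) (mlen β) h)
  rw [h2, norm_zero] at h1
  exact norm_le_zero_iff.mp h1

theorem abs_mpow_add_le {d : ℕ} (z a : E d) (α : Fin d → ℕ) :
    |mpow (z + a) α| ≤ ∑ S ∈ (Finset.univ : Finset (Fin d)).powerset, 2 ^ mlen α *
      (|mpow z (fun j => if j ∈ S then α j else 0)| *
        ∏ j ∈ Finset.univ \ S, ‖a‖ ^ α j) := by
  have h1 : |mpow (z + a) α| ≤ ∏ j, (2 ^ α j * (|z j| ^ α j + ‖a‖ ^ α j)) := by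
    unfold mpow
    rw [Finset.abs_prod]
    refine Finset.prod_le_prod (fun _ _ => abs_nonneg _) fun j _ => ?_
    rw [abs_pow]
    have h2 : |(z + a) j| ≤ |z j| + ‖a‖ :=
      (abs_add_le (z j) (a j)).trans (add_le_add le_rfl (PiLp.norm_apply_le a j))
    calc |(z + a) j| ^ α j ≤ (|z j| + ‖a‖) ^ α j := by gcongr
      _ ≤ 2 ^ (α j - 1) * (|z j| ^ α j + ‖a‖ ^ α j) :=
          add_pow_le (abs_nonneg _) (norm_nonneg _) _
      _ ≤ _ := by gcongr <;> norm_num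
  refine h1.trans (le_of_eq ?_)
  rw [Finset.prod_mul_distrib, Finset.prod_pow_eq_pow_sum, Finset.prod_add, Finset.mul_sum]
  refine Finset.sum_congr rfl fun S _ => ?_
  congr 2
  unfold mpow
  rw [Finset.abs_prod]
  rw [← Finset.prod_subset (Finset.subset_univ S)]
  · exact Finset.prod_congr rfl fun j hj => by simp [hj]
  · intro j _ hj; simp [hj]

/-! ### The Gelfand–Shilov space `Σ_t^s(ℝ^d)` of Beurling type and its dual -/

/-- The weight `h^{|α + β|} α!^t β!^s`. -/
noncomputable def gsWeight {d : ℕ} (t s h : ℝ) (α β : Fin d → ℕ) : ℝ :=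
  h ^ (mlen α + mlen β) * (mfact α : ℝ) ^ t * (mfact β : ℝ) ^ s

/-- Membership in `Σ_t^s(ℝ^d)`: `f` is smooth and, for every `h > 0`,
`sup_{α, β, x} |x^α D^β f(x)| / (h^{|α + β|} α!^t β!^s)` is finite. -/
def MemGS {d : ℕ} (t s : ℝ) (f : E d → ℂ) : Prop :=
  ContDiff ℝ ∞ f ∧ ∀ h : ℝ, 0 < h → ∃ C : ℝ, ∀ (α β : Fin d → ℕ) (x : E d),
    |mpow x α| * ‖mderiv β f x‖ ≤ C * gsWeight t s h α β

theorem gsWeight_pos {d : ℕ} (t s : ℝ) {h : ℝ} (hh : 0 < h) (α β : Fin d → ℕ) :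
    0 < gsWeight t s h α β := by
  have h1 := mfact_pos α
  have h2 := mfact_pos β
  unfold gsWeight
  positivity

theorem gsWeight_mono {d : ℕ} (t s : ℝ) {h k : ℝ} (hk : 0 < k) (hkh : k ≤ h) (α β : Fin d → ℕ) :
    gsWeight t s k α β ≤ gsWeight t s h α β := by
  have h1 := mfact_pos α
  have h2 := mfact_pos β
  unfold gsWeight
  gcongr

theorem gsWeight_split {d : ℕ} (t s h : ℝ) (α β : Fin d → ℕ) : gsWeight t s h α β =
    (h ^ mlen α * (mfact α : ℝ) ^ t) * (h ^ mlen β * (mfact β : ℝ) ^ s) := by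
  unfold gsWeight; rw [pow_add]; ring

theorem nonneg_of_bound {d : ℕ} {t s h C : ℝ} (hh : 0 < h) {f : E d → ℂ}
    (hC : ∀ (α β : Fin d → ℕ) (x : E d), |mpow x α| * ‖mderiv β f x‖ ≤ C * gsWeight t s h α β) :
    0 ≤ C := by
  have h1 := hC 0 0 0
  have h2 := gsWeight_pos t s hh (0 : Fin d → ℕ) 0
  have h3 : 0 ≤ C * gsWeight t s h (0 : Fin d → ℕ) 0 := le_trans (by positivity) h1
  exact nonneg_of_mul_nonneg_left h3 h2

/-- `Σ_t^s(ℝ^d)` as a space of functions. -/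
noncomputable def gsSubmodule (d : ℕ) (t s : ℝ) : Submodule ℂ (E d → ℂ) where
  carrier := {f | MemGS t s f}
  zero_mem' := ⟨contDiff_const, fun h _ => ⟨0, fun α β x => by simp [mderiv_zero]⟩⟩
  add_mem' := by
    rintro f g ⟨hf, hfb⟩ ⟨hg, hgb⟩
    refine ⟨hf.add hg, fun h hh => ?_⟩
    obtain ⟨C1, h1⟩ := hfb h hh
    obtain ⟨C2, h2⟩ := hgb h hh
    refine ⟨C1 + C2, fun α β x => ?_⟩
    rw [mderiv_add β hf hg]
    calc |mpow x α| * ‖mderiv β f x + mderiv β g x‖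
        ≤ |mpow x α| * (‖mderiv β f x‖ + ‖mderiv β g x‖) := by gcongr; exact norm_add_le _ _
      _ ≤ _ := by linarith [h1 α β x, h2 α β x]
  smul_mem' := by
    rintro c f ⟨hf, hfb⟩
    refine ⟨contDiff_const.smul hf, fun h hh => ?_⟩
    obtain ⟨C1, h1⟩ := hfb h hh
    refine ⟨‖c‖ * C1, fun α β x => ?_⟩
    rw [mderiv_smul β c hf, Pi.smul_apply, norm_smul]
    calc |mpow x α| * (‖c‖ * ‖mderiv β f x‖) = ‖c‖ * (|mpow x α| * ‖mderiv β f x‖) := by ring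
      _ ≤ ‖c‖ * (C1 * gsWeight t s h α β) :=
          mul_le_mul_of_nonneg_left (h1 α β x) (norm_nonneg c)
      _ = _ := by ring

/-- The Gelfand–Shilov space `Σ_t^s(ℝ^d)` of Beurling type; it is given its Fréchet space topology
below. -/
def GelfandShilov (d : ℕ) (t s : ℝ) : Type := ↥(gsSubmodule d t s)

noncomputable instance (d : ℕ) (t s : ℝ) : AddCommGroup (GelfandShilov d t s) :=
  inferInstanceAs (AddCommGroup ↥(gsSubmodule d t s))

noncomputable instance (d : ℕ) (t s : ℝ) : Module ℂ (GelfandShilov d t s) :=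
  inferInstanceAs (Module ℂ ↥(gsSubmodule d t s))

namespace GelfandShilov

variable {d : ℕ} {t s : ℝ}

/-- The underlying function of an element of `Σ_t^s(ℝ^d)`. -/
def toFun (f : GelfandShilov d t s) : E d → ℂ := f.1

/-- A function satisfying the defining estimates, as an element of `Σ_t^s(ℝ^d)`. -/
def mk (f : E d → ℂ) (hf : MemGS t s f) : GelfandShilov d t s := ⟨f, hf⟩

theorem mem (f : GelfandShilov d t s) : MemGS t s f.toFun := f.2

theorem toFun_mk (f : E d → ℂ) (hf : MemGS t s f) : (mk f hf).toFun = f := rfl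

theorem ext {f g : GelfandShilov d t s} (h : f.toFun = g.toFun) : f = g := Subtype.ext h

theorem toFun_add (f g : GelfandShilov d t s) : (f + g).toFun = f.toFun + g.toFun := rfl

theorem toFun_smul (c : ℂ) (f : GelfandShilov d t s) : (c • f).toFun = c • f.toFun := rfl

theorem toFun_zero : (0 : GelfandShilov d t s).toFun = 0 := rfl

/-- The quotient whose supremum over `α`, `β`, `x` is the norm of `f` in `S_{t,h}^s`. -/
noncomputable def ratio (h : ℝ) (f : GelfandShilov d t s)
    (p : (Fin d → ℕ) × (Fin d → ℕ) × E d) : ℝ :=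
  |mpow p.2.2 p.1| * ‖mderiv p.2.1 f.toFun p.2.2‖ / gsWeight t s h p.1 p.2.1

theorem ratio_nonneg {h : ℝ} (hh : 0 < h) (f : GelfandShilov d t s)
    (p : (Fin d → ℕ) × (Fin d → ℕ) × E d) : 0 ≤ ratio h f p :=
  div_nonneg (by positivity) (gsWeight_pos t s hh _ _).le

theorem bddAbove_ratio {h : ℝ} (hh : 0 < h) (f : GelfandShilov d t s) :
    BddAbove (Set.range (ratio h f)) := by
  obtain ⟨C, hC⟩ := f.mem.2 h hh
  refine ⟨C, ?_⟩
  rintro _ ⟨p, rfl⟩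
  exact (div_le_iff₀ (gsWeight_pos t s hh _ _)).mpr (hC _ _ _)

/-- The norm `‖f‖ = sup_{α, β, x} |x^α D^β f(x)| / (h^{|α + β|} α!^t β!^s)` of `S_{t,h}^s(ℝ^d)`,
as a seminorm on `Σ_t^s(ℝ^d)`, for `h > 0`. -/
noncomputable def seminorm (d : ℕ) (t s : ℝ) (h : {h : ℝ // 0 < h}) :
    Seminorm ℂ (GelfandShilov d t s) :=
  Seminorm.ofSMulLE (fun f => ⨆ p, ratio h.1 f p)
    (by
      have : ∀ p, ratio h.1 (0 : GelfandShilov d t s) p = 0 := by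
        intro p
        simp [ratio, toFun_zero, mderiv_zero]
      simp [this])
    (by
      intro f g
      refine ciSup_le fun p => ?_
      have h1 := le_ciSup (bddAbove_ratio h.2 f) p
      have h2 := le_ciSup (bddAbove_ratio h.2 g) p
      refine le_trans ?_ (add_le_add h1 h2)
      unfold ratio
      rw [← add_div, toFun_add, mderiv_add _ f.mem.1 g.mem.1, ← mul_add]
      refine div_le_div_of_nonneg_right ?_ (gsWeight_pos t s h.2 _ _).le
      exact mul_le_mul_of_nonneg_left (norm_add_le _ _) (abs_nonneg _))
    (by
      intro c f
      refine ciSup_le fun p => ?_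
      have h1 := le_ciSup (bddAbove_ratio h.2 f) p
      refine le_trans (le_of_eq ?_) (mul_le_mul_of_nonneg_left h1 (norm_nonneg c))
      unfold ratio
      rw [toFun_smul, mderiv_smul _ _ f.mem.1, Pi.smul_apply, norm_smul]
      ring)

theorem seminorm_apply (h : {h : ℝ // 0 < h}) (f : GelfandShilov d t s) :
    seminorm d t s h f = ⨆ p, ratio h.1 f p := rfl

theorem le_seminorm (h : {h : ℝ // 0 < h}) (f : GelfandShilov d t s) (α β : Fin d → ℕ) (x : E d) :
    |mpow x α| * ‖mderiv β f.toFun x‖ ≤ seminorm d t s h f * gsWeight t s h.1 α β := by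
  rw [← div_le_iff₀ (gsWeight_pos t s h.2 _ _)]
  exact le_ciSup (bddAbove_ratio h.2 f) (α, β, x)

theorem seminorm_le (h : {h : ℝ // 0 < h}) (f : GelfandShilov d t s) {C : ℝ}
    (hC : ∀ (α β : Fin d → ℕ) (x : E d),
      |mpow x α| * ‖mderiv β f.toFun x‖ ≤ C * gsWeight t s h.1 α β) :
    seminorm d t s h f ≤ C :=
  ciSup_le fun _ => (div_le_iff₀ (gsWeight_pos t s h.2 _ _)).mpr (hC _ _ _)

theorem seminorm_anti {h k : {h : ℝ // 0 < h}} (hkh : k.1 ≤ h.1) :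
    seminorm d t s h ≤ seminorm d t s k := by
  intro f
  refine seminorm_le h f fun α β x => (le_seminorm k f α β x).trans ?_
  exact mul_le_mul_of_nonneg_left (gsWeight_mono t s k.2 hkh α β) (apply_nonneg _ _)

instance : Nonempty {h : ℝ // 0 < h} := ⟨⟨1, one_pos⟩⟩

/-- The Fréchet space topology of `Σ_t^s(ℝ^d)`, defined by the norms of `S_{t,h}^s(ℝ^d)`,
`h > 0`. -/
noncomputable instance : TopologicalSpace (GelfandShilov d t s) :=
  (SeminormFamily.moduleFilterBasis (seminorm d t s)).topology

theorem withSeminorms (d : ℕ) (t s : ℝ) : WithSeminorms (seminorm d t s) := ⟨rfl⟩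

end GelfandShilov

/-- The space `(Σ_t^s)'(ℝ^d)` of Gelfand–Shilov ultradistributions: the topological dual. The value
`u f` is the bilinear pairing; the pairing which is conjugate linear in the test function is
`(u, f) = u (conj f)`. -/
abbrev GelfandShilovDual (d : ℕ) (t s : ℝ) : Type := GelfandShilov d t s →L[ℂ] ℂ

theorem memGS_modFun {d : ℕ} {t s : ℝ} (hs : 0 < s) (ξ : E d) {f : E d → ℂ}
    (hf : MemGS t s f) : MemGS t s (modFun ξ f) := by
  refine ⟨contDiff_modFun ξ hf.1, fun h hh => ?_⟩
  obtain ⟨C', k, hC1, hk, hkh, hC⟩ := mderiv_modFun_le hs ξ hh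
  obtain ⟨C, hCf⟩ := hf.2 k hk
  have hC0 := nonneg_of_bound hk hCf
  refine ⟨C' * C, fun α β x => ?_⟩
  have hα := mfact_pos α
  have h1 := hC f hf.1 |mpow x α| (C * (k ^ mlen α * (mfact α : ℝ) ^ t)) (abs_nonneg _)
    (by positivity) x (fun β => by
      have := hCf α β x
      rw [gsWeight_split] at this
      linarith) β
  refine h1.trans ?_
  rw [gsWeight_split]
  have hβ := mfact_pos β
  have h2 : k ^ mlen α ≤ h ^ mlen α := by gcongr
  calc C' * (C * (k ^ mlen α * (mfact α : ℝ) ^ t)) * (h ^ mlen β * (mfact β : ℝ) ^ s)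
      ≤ C' * (C * (h ^ mlen α * (mfact α : ℝ) ^ t)) * (h ^ mlen β * (mfact β : ℝ) ^ s) := by
        gcongr
    _ = _ := by ring

theorem memGS_conjFun {d : ℕ} {t s : ℝ} {f : E d → ℂ} (hf : MemGS t s f) :
    MemGS t s (conjFun f) := by
  refine ⟨Complex.conjCLE.contDiff.comp hf.1, fun h hh => ?_⟩
  obtain ⟨C, hC⟩ := hf.2 h hh
  refine ⟨C, fun α β x => ?_⟩
  rw [mderiv_conjFun]
  change _ * ‖starRingEnd ℂ (mderiv β f x)‖ ≤ _
  rw [RCLike.norm_conj]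
  exact hC α β x

theorem memGS_transFun {d : ℕ} {t s : ℝ} (ht : 0 < t) (a : E d) {f : E d → ℂ}
    (hf : MemGS t s f) : MemGS t s (transFun a f) := by
  refine ⟨hf.1.comp (contDiff_id.sub contDiff_const), fun h hh => ?_⟩
  obtain ⟨C, hC⟩ := hf.2 (h / 2) (by positivity)
  have hC0 := nonneg_of_bound (by positivity) hC
  obtain ⟨C', hC1, hC'⟩ := exists_pow_le ht ‖a‖ (norm_nonneg _) (k := h / 2) (by positivity)
  have hC'0 : 0 ≤ C' := by linarith
  refine ⟨2 ^ d * (C * C' ^ d), fun α β x => ?_⟩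
  rw [mderiv_transFun]
  set z := x - a with hz
  have hx : x = z + a := by simp [hz]
  change |mpow x α| * ‖mderiv β f z‖ ≤ _
  have hβ := mfact_pos β
  have key : ∀ S : Finset (Fin d), 2 ^ mlen α *
      (|mpow z (fun j => if j ∈ S then α j else 0)| * ∏ j ∈ Finset.univ \ S, ‖a‖ ^ α j) *
        ‖mderiv β f z‖ ≤ C * C' ^ d * gsWeight t s h α β := by
    intro S
    set γ : Fin d → ℕ := fun j => if j ∈ S then α j else 0 with hγ
    have e1 := hC γ β z
    have e2 : ∏ j ∈ Finset.univ \ S, ‖a‖ ^ α j ≤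
        C' ^ d * ∏ j ∈ Finset.univ \ S, ((h / 2) ^ α j * ((α j)! : ℝ) ^ t) := by
      calc ∏ j ∈ Finset.univ \ S, ‖a‖ ^ α j
          ≤ ∏ j ∈ Finset.univ \ S, C' * ((h / 2) ^ α j * ((α j)! : ℝ) ^ t) :=
            Finset.prod_le_prod (fun _ _ => by positivity) fun j _ => hC' _
        _ = C' ^ (Finset.univ \ S).card *
            ∏ j ∈ Finset.univ \ S, ((h / 2) ^ α j * ((α j)! : ℝ) ^ t) := by
            rw [Finset.prod_mul_distrib, Finset.prod_const]
        _ ≤ _ := by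
            refine mul_le_mul_of_nonneg_right (pow_le_pow_right₀ hC1 ?_)
              (Finset.prod_nonneg fun _ _ => by positivity)
            exact (Finset.card_le_univ _).trans (by simp)
    have e3 : ((h / 2) ^ mlen γ * (mfact γ : ℝ) ^ t) *
        ∏ j ∈ Finset.univ \ S, ((h / 2) ^ α j * ((α j)! : ℝ) ^ t) =
        (h / 2) ^ mlen α * (mfact α : ℝ) ^ t := by
      have g : ∀ δ : Fin d → ℕ, (h / 2) ^ mlen δ * (mfact δ : ℝ) ^ t =
          ∏ j, ((h / 2) ^ δ j * ((δ j)! : ℝ) ^ t) := by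
        intro δ
        unfold mlen mfact
        push_cast
        rw [Finset.prod_mul_distrib, Finset.prod_pow_eq_pow_sum,
          Real.finsetProd_rpow _ _ (fun _ _ => by positivity)]
      rw [g, g]
      have g2 : ∏ j, ((h / 2) ^ γ j * ((γ j)! : ℝ) ^ t) =
          ∏ j ∈ S, ((h / 2) ^ α j * ((α j)! : ℝ) ^ t) := by
        rw [← Finset.prod_subset (Finset.subset_univ S)]
        · exact Finset.prod_congr rfl fun j hj => by simp [hγ, hj]
        · intro j _ hj; simp [hγ, hj]
      rw [g2, mul_comm, Finset.prod_sdiff (Finset.subset_univ S)]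
    rw [gsWeight_split] at e1
    set P := ∏ j ∈ Finset.univ \ S, ‖a‖ ^ α j
    set Q := ∏ j ∈ Finset.univ \ S, ((h / 2) ^ α j * ((α j)! : ℝ) ^ t)
    have hP : 0 ≤ P := Finset.prod_nonneg fun _ _ => by positivity
    have hγ0 := mfact_pos γ
    have hα0 := mfact_pos α
    have hh2 : (h / 2) ^ mlen β ≤ h ^ mlen β := by gcongr; linarith
    calc 2 ^ mlen α * (|mpow z γ| * P) * ‖mderiv β f z‖
        = 2 ^ mlen α * ((|mpow z γ| * ‖mderiv β f z‖) * P) := by ring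
      _ ≤ 2 ^ mlen α * ((C * (((h / 2) ^ mlen γ * (mfact γ : ℝ) ^ t) *
          ((h / 2) ^ mlen β * (mfact β : ℝ) ^ s))) * (C' ^ d * Q)) := by gcongr
      _ = C * C' ^ d * (2 ^ mlen α * (((h / 2) ^ mlen γ * (mfact γ : ℝ) ^ t) * Q) *
          ((h / 2) ^ mlen β * (mfact β : ℝ) ^ s)) := by ring
      _ = C * C' ^ d * ((h ^ mlen α * (mfact α : ℝ) ^ t) *
          ((h / 2) ^ mlen β * (mfact β : ℝ) ^ s)) := by
          rw [e3]; congr 2; rw [← mul_assoc, ← mul_pow]; congr 2; ring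
      _ ≤ C * C' ^ d * ((h ^ mlen α * (mfact α : ℝ) ^ t) *
          (h ^ mlen β * (mfact β : ℝ) ^ s)) := by gcongr
      _ = _ := by rw [gsWeight_split]
  calc |mpow x α| * ‖mderiv β f z‖
      ≤ (∑ S ∈ (Finset.univ : Finset (Fin d)).powerset, 2 ^ mlen α *
      (|mpow z (fun j => if j ∈ S then α j else 0)| *
        ∏ j ∈ Finset.univ \ S, ‖a‖ ^ α j)) * ‖mderiv β f z‖ := by
        rw [hx]; gcongr; exact abs_mpow_add_le z a α
    _ ≤ ∑ S ∈ (Finset.univ : Finset (Fin d)).powerset, C * C' ^ d * gsWeight t s h α β := by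
        rw [Finset.sum_mul]
        exact Finset.sum_le_sum fun S _ => key S
    _ = _ := by
        rw [Finset.sum_const, Finset.card_powerset]
        simp; ring

namespace GelfandShilov

variable {d : ℕ} {t s : ℝ}

/-- Modulation `M_ξ f(y) = e^{i⟨y, ξ⟩} f(y)` on `Σ_t^s(ℝ^d)`. -/
noncomputable def modulate (hs : 0 < s) (ξ : E d) (f : GelfandShilov d t s) :
    GelfandShilov d t s := mk (modFun ξ f.toFun) (memGS_modFun hs ξ f.mem)

/-- Translation `T_x f(y) = f(y - x)` on `Σ_t^s(ℝ^d)`. -/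
noncomputable def translate (ht : 0 < t) (x : E d) (f : GelfandShilov d t s) :
    GelfandShilov d t s := mk (transFun x f.toFun) (memGS_transFun ht x f.mem)

/-- Complex conjugation on `Σ_t^s(ℝ^d)`. -/
noncomputable def conj (f : GelfandShilov d t s) : GelfandShilov d t s :=
  mk (conjFun f.toFun) (memGS_conjFun f.mem)

end GelfandShilov

/-- The short-time Fourier transform
`V_ψ u(x, ξ) = (2π)^{-d/2} (u, M_ξ T_x ψ)` of `u ∈ (Σ_t^s)'(ℝ^d)` with window `ψ ∈ Σ_t^s(ℝ^d)`,
where the pairing is conjugate linear in the test function. -/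
noncomputable def stft {d : ℕ} {t s : ℝ} (ht : 0 < t) (hs : 0 < s) (ψ : GelfandShilov d t s)
    (u : GelfandShilovDual d t s) (x ξ : E d) : ℂ :=
  (((2 * Real.pi) ^ (-(d : ℝ) / 2) : ℝ) : ℂ) * u ((ψ.translate ht x).modulate hs ξ).conj

/-- The `t,s`-Gelfand–Shilov wave front set `WF^{t,s}(u) ⊆ T^*ℝ^d ∖ 0`, computed with the window
`ψ`: a point `(x₀, ξ₀) ≠ 0` lies outside it iff it has an open neighbourhood `U ⊆ T^*ℝ^d ∖ 0` with
`sup_{λ > 0, (x, ξ) ∈ U} e^{rλ} |V_ψ u(λ^t x, λ^s ξ)| < ∞` for all `r > 0`. -/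
def gsWaveFrontSet {d : ℕ} {t s : ℝ} (ht : 0 < t) (hs : 0 < s) (ψ : GelfandShilov d t s)
    (u : GelfandShilovDual d t s) : Set (E d × E d) :=
  {z₀ | z₀ ≠ 0 ∧ ¬ ∃ U : Set (E d × E d), IsOpen U ∧ (0 : E d × E d) ∉ U ∧ z₀ ∈ U ∧
    ∀ r : ℝ, 0 < r → ∃ C : ℝ, ∀ l : ℝ, 0 < l → ∀ z ∈ U,
      Real.exp (r * l) * ‖stft ht hs ψ u (l ^ t • z.1) (l ^ s • z.2)‖ ≤ C}

/-! ### Gevrey functions, Gevrey ultradistributions and the Gevrey wave front set -/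

/-- Membership in `G^s(ℝ^d)` (Beurling type): `f` is smooth and for each compact `K` and each
`h > 0` there is `C` with `|∂^α f(x)| ≤ C h^{|α|} α!^s` for `x ∈ K` and all `α`. -/
def IsGevrey {d : ℕ} (s : ℝ) (f : E d → ℂ) : Prop :=
  ContDiff ℝ ∞ f ∧ ∀ K : Set (E d), IsCompact K → ∀ h : ℝ, 0 < h → ∃ C : ℝ, ∀ x ∈ K,
    ∀ α : Fin d → ℕ, ‖mderiv α f x‖ ≤ C * (h ^ mlen α * (mfact α : ℝ) ^ s)

theorem isGevrey_modFun {d : ℕ} {s : ℝ} (hs : 0 < s) (ξ : E d) {f : E d → ℂ}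
    (hf : IsGevrey s f) : IsGevrey s (modFun ξ f) := by
  refine ⟨contDiff_modFun ξ hf.1, fun K hK h hh => ?_⟩
  obtain ⟨C', k, hC1, hk, hkh, hC⟩ := mderiv_modFun_le hs ξ hh
  obtain ⟨C, hCf⟩ := hf.2 K hK k hk
  refine ⟨C' * C, fun x hx α => ?_⟩
  have hC0 : 0 ≤ C := by
    have h1 := (norm_nonneg _).trans (hCf x hx 0)
    have h2 := mfact_pos (0 : Fin d → ℕ)
    exact nonneg_of_mul_nonneg_left h1 (by positivity)
  have := hC f hf.1 1 C zero_le_one hC0 x (fun β => by rw [one_mul]; exact hCf x hx β) α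
  rwa [one_mul] at this

/-- The space `G_c^s(ℝ^d)` of compactly supported Gevrey functions of order `s`. -/
noncomputable def gevreyC (d : ℕ) (s : ℝ) : Submodule ℂ (E d → ℂ) where
  carrier := {f | IsGevrey s f ∧ HasCompactSupport f}
  zero_mem' := ⟨⟨contDiff_const, fun K _ h _ => ⟨0, fun x _ α => by simp [mderiv_zero]⟩⟩,
    HasCompactSupport.zero⟩
  add_mem' := by
    rintro f g ⟨⟨hf, hfb⟩, hfc⟩ ⟨⟨hg, hgb⟩, hgc⟩
    refine ⟨⟨hf.add hg, fun K hK h hh => ?_⟩, hfc.add hgc⟩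
    obtain ⟨C1, h1⟩ := hfb K hK h hh
    obtain ⟨C2, h2⟩ := hgb K hK h hh
    refine ⟨C1 + C2, fun x hx α => ?_⟩
    rw [mderiv_add α hf hg, add_mul]
    exact (norm_add_le _ _).trans (add_le_add (h1 x hx α) (h2 x hx α))
  smul_mem' := by
    rintro c f ⟨⟨hf, hfb⟩, hfc⟩
    refine ⟨⟨contDiff_const.smul hf, fun K hK h hh => ?_⟩, hfc.smul_left (f := fun _ => c)⟩
    obtain ⟨C1, h1⟩ := hfb K hK h hh
    refine ⟨‖c‖ * C1, fun x hx α => ?_⟩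
    rw [mderiv_smul α c hf, Pi.smul_apply, norm_smul, mul_assoc]
    exact mul_le_mul_of_nonneg_left (h1 x hx α) (norm_nonneg c)

/-- Modulation `M_ξ f(y) = e^{i⟨y, ξ⟩} f(y)` on `G_c^s(ℝ^d)`. -/
noncomputable def gevreyModulate {d : ℕ} {s : ℝ} (hs : 0 < s) (ξ : E d) (f : gevreyC d s) :
    gevreyC d s :=
  ⟨modFun ξ f.1, isGevrey_modFun hs ξ f.2.1, f.2.2.mul_left⟩

/-- The space `𝒟_s'(ℝ^d)` of Gevrey ultradistributions (Beurling type): the linear functionals on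
`G_c^s(ℝ^d)` whose restriction to the Fréchet space of functions of `G_c^s(ℝ^d)` supported in `K`,
normed by `sup_{α, x} |∂^α f(x)| / (h^{|α|} α!^s)` for `h > 0`, is continuous for each
compact `K`. -/
structure GevreyUltradistribution (d : ℕ) (s : ℝ) where
  /-- The functional; its value at `f` is the bilinear pairing. -/
  toLinearMap : gevreyC d s →ₗ[ℂ] ℂ
  continuous' : ∀ K : Set (E d), IsCompact K → ∃ h : ℝ, 0 < h ∧ ∃ C : ℝ, ∀ f : gevreyC d s,
    tsupport f.1 ⊆ K → ∀ B : ℝ,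
      (∀ (α : Fin d → ℕ) (x : E d), ‖mderiv α f.1 x‖ ≤ B * (h ^ mlen α * (mfact α : ℝ) ^ s)) →
      ‖toLinearMap f‖ ≤ C * B

/-- The Fourier transform `ξ ↦ (2π)^{-d/2} ⟨v χ, e^{-i⟨·, ξ⟩}⟩ = (2π)^{-d/2} ⟨v, χ e^{-i⟨·, ξ⟩}⟩` of
the compactly supported ultradistribution `v χ`, where `v ∈ 𝒟_s'(ℝ^d)` and `χ ∈ G_c^s(ℝ^d)`. -/
noncomputable def localFourier {d : ℕ} {s : ℝ} (hs : 0 < s) (v : GevreyUltradistribution d s)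
    (χ : gevreyC d s) (ξ : E d) : ℂ :=
  (((2 * Real.pi) ^ (-(d : ℝ) / 2) : ℝ) : ℂ) * v.toLinearMap (gevreyModulate hs (-ξ) χ)

/-- The Gevrey wave front set `WF_s(v) ⊆ ℝ^d × (ℝ^d ∖ 0)` of `v ∈ 𝒟_s'(ℝ^d)`: a point `(x₀, ξ₀)`
with `ξ₀ ≠ 0` lies outside it iff there are `χ ∈ G_c^s(ℝ^d)` with `χ(x₀) = 1` and an open conic set
`Γ ⊆ ℝ^d ∖ 0` containing `ξ₀` such that `sup_{ξ ∈ Γ} e^{r |ξ|^{1/s}} |(v χ)^(ξ)| < ∞` for all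
`r > 0`. -/
def gevreyWaveFrontSet {d : ℕ} {s : ℝ} (hs : 0 < s) (v : GevreyUltradistribution d s) :
    Set (E d × E d) :=
  {z₀ | z₀.2 ≠ 0 ∧ ¬ ∃ χ : gevreyC d s, χ.1 z₀.1 = 1 ∧ ∃ Γ : Set (E d), IsOpen Γ ∧
    (∀ l : ℝ, 0 < l → ∀ ξ ∈ Γ, l • ξ ∈ Γ) ∧ (0 : E d) ∉ Γ ∧ z₀.2 ∈ Γ ∧
    ∀ r : ℝ, 0 < r → ∃ C : ℝ, ∀ ξ ∈ Γ,
      Real.exp (r * ‖ξ‖ ^ (1 / s)) * ‖localFourier hs v χ ξ‖ ≤ C}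

/-! ### The inclusions `G_c^s ⊆ Σ_t^s` and `(Σ_t^s)' ⊆ 𝒟_s'` -/

theorem exists_mpow_le {d : ℕ} {t : ℝ} (ht : 0 < t) {K : Set (E d)} (hK : IsCompact K) {h : ℝ}
    (hh : 0 < h) : ∃ M : ℝ, 0 < M ∧ ∀ x ∈ K, ∀ α : Fin d → ℕ,
      |mpow x α| ≤ M * (h ^ mlen α * (mfact α : ℝ) ^ t) := by
  obtain ⟨R, hR⟩ := hK.isBounded.exists_norm_le
  obtain ⟨C, hC1, hC⟩ := exists_pow_le ht (max R 0) (le_max_right _ _) hh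
  refine ⟨C ^ d, by positivity, fun x hx α => ?_⟩
  have hw : h ^ mlen α * (mfact α : ℝ) ^ t = ∏ j, (h ^ α j * ((α j)! : ℝ) ^ t) := by
    unfold mlen mfact
    push_cast
    rw [Finset.prod_mul_distrib, Finset.prod_pow_eq_pow_sum,
      Real.finsetProd_rpow _ _ (fun _ _ => by positivity)]
  calc |mpow x α| = ∏ j, |x j| ^ α j := by unfold mpow; rw [Finset.abs_prod]; simp
    _ ≤ ∏ j, C * (h ^ α j * ((α j)! : ℝ) ^ t) := by
        refine Finset.prod_le_prod (fun _ _ => by positivity) fun j _ => ?_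
        refine le_trans ?_ (hC (α j))
        have h1 : |x j| ≤ max R 0 :=
          ((PiLp.norm_apply_le x j).trans (hR x hx)).trans (le_max_left _ _)
        gcongr
    _ = _ := by rw [Finset.prod_mul_distrib, hw]; simp

theorem mul_mderiv_le {d : ℕ} {t s h M B : ℝ} {K : Set (E d)} (hh : 0 < h) (hM : 0 < M)
    (hMK : ∀ x ∈ K, ∀ α : Fin d → ℕ, |mpow x α| ≤ M * (h ^ mlen α * (mfact α : ℝ) ^ t))
    {f : E d → ℂ} (hf : ContDiff ℝ ∞ f) (hfK : tsupport f ⊆ K) (hB : 0 ≤ B)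
    (hfB : ∀ x ∈ K, ∀ α : Fin d → ℕ, ‖mderiv α f x‖ ≤ B * (h ^ mlen α * (mfact α : ℝ) ^ s))
    (α β : Fin d → ℕ) (x : E d) :
    |mpow x α| * ‖mderiv β f x‖ ≤ M * B * gsWeight t s h α β := by
  by_cases hx : x ∈ tsupport f
  · have h1 := hMK x (hfK hx) α
    have h2 := hfB x (hfK hx) β
    have hα := mfact_pos α
    calc |mpow x α| * ‖mderiv β f x‖
        ≤ (M * (h ^ mlen α * (mfact α : ℝ) ^ t)) * (B * (h ^ mlen β * (mfact β : ℝ) ^ s)) := by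
          gcongr
      _ = _ := by rw [gsWeight_split]; ring
  · rw [mderiv_eq_zero_of_notMem β hf hx, norm_zero, mul_zero]
    have := gsWeight_pos t s hh α β
    positivity

theorem memGS_of_gevreyC {d : ℕ} {t s : ℝ} (ht : 0 < t) {f : E d → ℂ} (hf : f ∈ gevreyC d s) :
    MemGS t s f := by
  obtain ⟨⟨hf, hfb⟩, hfc⟩ := hf
  refine ⟨hf, fun h hh => ?_⟩
  have hK : IsCompact (tsupport f) := hfc
  obtain ⟨C, hC⟩ := hfb _ hK h hh
  obtain ⟨M, hM, hMK⟩ := exists_mpow_le ht hK hh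
  refine ⟨M * max C 0, fun α β x => mul_mderiv_le hh hM hMK hf subset_rfl (le_max_right _ _) ?_ α β x⟩
  intro x hx α
  refine (hC x hx α).trans ?_
  have hα := mfact_pos α
  gcongr
  exact le_max_left _ _

/-- The inclusion `G_c^s(ℝ^d) ⊆ Σ_t^s(ℝ^d)`. -/
noncomputable def gevreyInclusion (d : ℕ) {t : ℝ} (s : ℝ) (ht : 0 < t) :
    gevreyC d s →ₗ[ℂ] GelfandShilov d t s where
  toFun f := GelfandShilov.mk f.1 (memGS_of_gevreyC ht f.2)
  map_add' _ _ := rfl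
  map_smul' _ _ := rfl

/-- The inclusion `(Σ_t^s)'(ℝ^d) ⊆ 𝒟_s'(ℝ^d)`: restriction of `u` to `G_c^s(ℝ^d)`. -/
noncomputable def GelfandShilovDual.toGevrey {d : ℕ} {t s : ℝ} (ht : 0 < t)
    (u : GelfandShilovDual d t s) : GevreyUltradistribution d s where
  toLinearMap := u.toLinearMap ∘ₗ gevreyInclusion d s ht
  continuous' := by
    intro K hK
    obtain ⟨S, C, -, hC⟩ := Seminorm.bound_of_continuous (GelfandShilov.withSeminorms d t s)
      ((normSeminorm ℂ ℂ).comp u.toLinearMap) (continuous_norm.comp u.continuous)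
    obtain ⟨k, hk⟩ : ∃ k : {h : ℝ // 0 < h}, S.sup (GelfandShilov.seminorm d t s) ≤
        GelfandShilov.seminorm d t s k := by
      clear hC
      induction S using Finset.induction with
      | empty => exact ⟨⟨1, one_pos⟩, by simp⟩
      | insert h S _ ih =>
        obtain ⟨k, hk⟩ := ih
        refine ⟨⟨min h.1 k.1, lt_min h.2 k.2⟩, ?_⟩
        rw [Finset.sup_insert]
        exact sup_le (GelfandShilov.seminorm_anti (min_le_left _ _))
          (hk.trans (GelfandShilov.seminorm_anti (min_le_right _ _)))
    obtain ⟨M, hM, hMK⟩ := exists_mpow_le ht hK k.2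
    refine ⟨k.1, k.2, C * M, fun f hf B hB => ?_⟩
    have hB0 : 0 ≤ B := by
      have h1 := (norm_nonneg _).trans (hB 0 0)
      have h2 := mfact_pos (0 : Fin d → ℕ)
      have h3 := k.2
      exact nonneg_of_mul_nonneg_left h1 (by positivity)
    have h1 : ‖u (gevreyInclusion d s ht f)‖ ≤
        (C • S.sup (GelfandShilov.seminorm d t s)) (gevreyInclusion d s ht f) := hC _
    have h2 : GelfandShilov.seminorm d t s k (gevreyInclusion d s ht f) ≤ M * B :=
      GelfandShilov.seminorm_le k _
        (mul_mderiv_le k.2 hM hMK f.2.1.1 hf hB0 fun x _ α => hB α x)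
    calc ‖u (gevreyInclusion d s ht f)‖
        ≤ C * S.sup (GelfandShilov.seminorm d t s) (gevreyInclusion d s ht f) := h1
      _ ≤ C * (M * B) := by
          gcongr
          exact (hk _).trans h2
      _ = _ := by ring

end GelfandShilovWF

namespace GelfandShilovWF

/-! ### Factorial estimates -/

/-! Suppose `(0, ξ₀) ∉ WF^{t,s}(u)` and fix any `x`. The point `(x, ξ)` lies on the curve `λ ↦ (λ^t
x', λ^s ξ')` with `x' = λ^{-t} x` and `ξ' = λ^{-s} ξ`. As `ξ` tends to infinity in a thin cone about
`ξ₀`, one may take `λ` comparable to `|ξ|^{1/s}`, so `x'` tends to `0` and `(x', ξ')` falls into the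
neighbourhood of `(0, ξ₀)` where decay is known. Hence `V_ψ u(x, ·)` decays faster than every
`e^{-r|ξ|^{1/s}}` in a cone about `ξ₀`, for every fixed `x` (`exists_cone_decay`).

For fixed `x`, `V_ψ u(x, ·)` is the Fourier transform of `u` times `p = conj ψ(· - x)`, which need
not have compact support. Given `x₀`, choose `x` with `p(x₀) ≠ 0` and a compactly supported Gevrey
function `g` such that `χ = p g` equals `1` at `x₀`. The transform of `u χ` is then the convolution
of `V_ψ u(x, ·)` with the transform of `g` (`localFourier_eq_integral`). That transform decays
faster than every `e^{-ρ|w|^{1/s}}` (`norm_fourier_le`), while `V_ψ u(x, ·)` grows at most like some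
`e^{r₁|ξ|^{1/s}}`. Such a convolution keeps the decay in a smaller cone (`exists_translate_decay`),
so `(x₀, ξ₀) ∉ WF_s(u)`.

Two ingredients need work. The cut-off `g` exists because `s > 1`: it is built from `exp(-x^{-m})`,
whose Gevrey order `1 + 1/m` is below `s` for large `m`. The convolution formula requires moving `u`
inside an integral of test functions (`GelfandShilovDual.apply_eq_integral`). By Hahn–Banach `u`
factors through a Banach space of bounded functions, where Bochner integrals commute with
functionals. -/

theorem pow_le_exp_mul_factorial {σ : ℝ} (hσ : 0 < σ) {R k : ℝ} (hR : 0 ≤ R) (hk : 0 < k) (n : ℕ) :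
    R ^ n ≤ Real.exp (σ * (R / k) ^ (1 / σ)) * (k ^ n * (n ! : ℝ) ^ σ) := by
  -- The estimate is `y^n / n! ≤ e^y` at `y = (R/k)^{1/σ}`, raised to the power `σ`.
  have h1 := Real.pow_div_factorial_le_exp (x := (R / k) ^ (1 / σ)) (by positivity) n
  have h2 : (((R / k) ^ (1 / σ)) ^ n / (n ! : ℝ)) ^ σ ≤ Real.exp ((R / k) ^ (1 / σ)) ^ σ :=
    Real.rpow_le_rpow (by positivity) h1 hσ.le
  rw [Real.div_rpow (by positivity) (by positivity), ← Real.rpow_natCast, ← Real.rpow_mul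
    (by positivity), ← Real.rpow_mul (by positivity), ← Real.exp_mul] at h2
  have h3 : 1 / σ * ((n : ℝ) * σ) = n := by field_simp
  rw [h3, Real.rpow_natCast, div_pow, div_le_iff₀ (by positivity),
    div_le_iff₀ (by positivity), mul_comm _ σ] at h2
  linarith

theorem factorial_rpow_mul_le {s : ℝ} (hs : 0 ≤ s) {i n : ℕ} (hin : i ≤ n) :
    (i ! : ℝ) ^ s * ((n - i)! : ℝ) ^ s ≤ (n ! : ℝ) ^ s := by
  rw [← Real.mul_rpow (by positivity) (by positivity)]
  refine Real.rpow_le_rpow (by positivity) ?_ hs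
  exact_mod_cast Nat.le_of_dvd (Nat.factorial_pos _)
    (Nat.factorial_mul_factorial_dvd_factorial hin)

/-- Factorial bounds for all powers imply exponential decay. -/
theorem exp_mul_le_of_pow_mul_le {s : ℝ} (hs : 0 < s) {R a C k ρ : ℝ} (hR : 0 ≤ R) (ha : 0 ≤ a)
    (hC : 0 ≤ C) (hk : 0 < k) (hρ : 0 ≤ ρ) (hρk : ρ / s * k ^ (1 / s) ≤ 1 / 2)
    (h : ∀ n : ℕ, R ^ n * a ≤ C * (k ^ n * (n ! : ℝ) ^ s)) :
    Real.exp (ρ * R ^ (1 / s)) * a ≤ 2 ^ s * C := by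
  have hs' : s * (1 / s) = 1 := by field_simp
  -- The power `1/s` turns `n!^s` into `n!`, so the bounds can be summed against the exponential
  -- series with rate `ρ/s`. By `hρk` the right-hand side is geometric with ratio `1/2`; its sum `2`
  -- becomes `2^s` when the power `s` is taken at the end.
  have hterm : ∀ n : ℕ, (ρ / s * R ^ (1 / s)) ^ n / (n ! : ℝ) * a ^ (1 / s) ≤
      C ^ (1 / s) * (1 / 2) ^ n := by
    intro n
    have h1 := Real.rpow_le_rpow (by positivity) (h n) (z := 1 / s) (by positivity)
    rw [Real.mul_rpow (by positivity) ha, Real.mul_rpow hC (by positivity),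
      Real.mul_rpow (by positivity) (by positivity), ← Real.rpow_mul (by positivity), hs',
      Real.rpow_one, ← Real.rpow_pow_comm hR, ← Real.rpow_pow_comm hk.le] at h1
    calc (ρ / s * R ^ (1 / s)) ^ n / (n ! : ℝ) * a ^ (1 / s)
        = (ρ / s) ^ n / (n ! : ℝ) * ((R ^ (1 / s)) ^ n * a ^ (1 / s)) := by rw [mul_pow]; ring
      _ ≤ (ρ / s) ^ n / (n ! : ℝ) * (C ^ (1 / s) * ((k ^ (1 / s)) ^ n * (n ! : ℝ))) := by gcongr
      _ = C ^ (1 / s) * (ρ / s * k ^ (1 / s)) ^ n := by rw [mul_pow]; field_simp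
      _ ≤ _ := by gcongr
  have hsum : Real.exp (ρ / s * R ^ (1 / s)) * a ^ (1 / s) ≤ C ^ (1 / s) * 2 := by
    have h1 : HasSum (fun n : ℕ => (ρ / s * R ^ (1 / s)) ^ n / (n ! : ℝ))
        (Real.exp (ρ / s * R ^ (1 / s))) := by
      rw [Real.exp_eq_exp_ℝ]; exact NormedSpace.expSeries_div_hasSum_exp _
    exact hasSum_le hterm (h1.mul_right _) (hasSum_geometric_two.mul_left _)
  have h2 := Real.rpow_le_rpow (by positivity) hsum hs.le
  rw [Real.mul_rpow (by positivity) (by positivity), Real.mul_rpow (by positivity) (by positivity),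
    ← Real.rpow_mul ha, ← Real.rpow_mul hC, mul_comm (1 / s), hs', Real.rpow_one, Real.rpow_one,
    ← Real.exp_mul] at h2
  have h3 : ρ / s * R ^ (1 / s) * s = ρ * R ^ (1 / s) := by field_simp
  rw [h3] at h2
  linarith

/-! ### Leibniz estimates and uniformly Gevrey functions -/

section Product

variable {X : Type*} [NormedAddCommGroup X] [NormedSpace ℝ X]

/-- Leibniz' rule: `i!^s (n-i)!^s ≤ n!^s`, and the binomial coefficients sum to `2^n`, which doubles
`k`. The two factors carry separate weights at the same point, so that growth of one can be paid for
by decay of the other. -/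
theorem mul_norm_iteratedFDeriv_mul_le {s : ℝ} (hs : 0 ≤ s) {a f : X → ℂ}
    (ha : ContDiff ℝ ∞ a) (hf : ContDiff ℝ ∞ f) {A B V W k : ℝ} (hk : 0 < k)
    (hW : 0 ≤ W) (hV : 0 ≤ V) (hA0 : 0 ≤ A) {x : X}
    (hA : ∀ n : ℕ, V * ‖iteratedFDeriv ℝ n a x‖ ≤ A * (k ^ n * (n ! : ℝ) ^ s))
    (hB : ∀ n : ℕ, W * ‖iteratedFDeriv ℝ n f x‖ ≤ B * (k ^ n * (n ! : ℝ) ^ s)) (n : ℕ) :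
    V * W * ‖iteratedFDeriv ℝ n (fun y => a y * f y) x‖ ≤
      A * B * ((2 * k) ^ n * (n ! : ℝ) ^ s) := by
  have hB0 : 0 ≤ B := by
    have h1 := (by positivity : 0 ≤ W * ‖iteratedFDeriv ℝ 0 f x‖).trans (hB 0)
    simpa using h1
  calc V * W * ‖iteratedFDeriv ℝ n (fun y => a y * f y) x‖
      ≤ V * W * ∑ i ∈ Finset.range (n + 1), (n.choose i : ℝ) *
        ‖iteratedFDeriv ℝ i a x‖ * ‖iteratedFDeriv ℝ (n - i) f x‖ :=
        mul_le_mul_of_nonneg_left (norm_iteratedFDeriv_mul_le ha hf x (n := n)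
          (by exact_mod_cast le_top)) (by positivity)
    _ ≤ ∑ i ∈ Finset.range (n + 1), (n.choose i : ℝ) * (A * B * (k ^ n * (n ! : ℝ) ^ s)) := by
        rw [Finset.mul_sum]
        refine Finset.sum_le_sum fun i hi => ?_
        have hin : i ≤ n := Nat.lt_succ_iff.mp (Finset.mem_range.mp hi)
        have hkn : k ^ i * k ^ (n - i) = k ^ n := by rw [← pow_add]; congr 1; omega
        calc V * W * ((n.choose i : ℝ) * ‖iteratedFDeriv ℝ i a x‖ * ‖iteratedFDeriv ℝ (n - i) f x‖)
            = (n.choose i : ℝ) * ((V * ‖iteratedFDeriv ℝ i a x‖) *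
              (W * ‖iteratedFDeriv ℝ (n - i) f x‖)) := by ring
          _ ≤ (n.choose i : ℝ) * ((A * (k ^ i * (i ! : ℝ) ^ s)) *
              (B * (k ^ (n - i) * ((n - i)! : ℝ) ^ s))) := by
              exact mul_le_mul_of_nonneg_left (mul_le_mul (hA i) (hB _) (by positivity)
                (by positivity)) (by positivity)
          _ = (n.choose i : ℝ) * (A * B * ((k ^ i * k ^ (n - i)) *
              ((i ! : ℝ) ^ s * ((n - i)! : ℝ) ^ s))) := by ring
          _ ≤ _ := by rw [hkn]; gcongr; exact factorial_rpow_mul_le hs hin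
    _ = A * B * ((2 * k) ^ n * (n ! : ℝ) ^ s) := by
        rw [← Finset.sum_mul]
        have : ∑ i ∈ Finset.range (n + 1), (n.choose i : ℝ) = 2 ^ n := by
          exact_mod_cast Nat.sum_range_choose n
        rw [this, mul_pow]; ring

/-- Smooth functions satisfying Gevrey estimates of order `s` (Beurling type) uniformly on the whole
space. -/
def IsUniformGevrey (s : ℝ) (f : X → ℂ) : Prop :=
  ContDiff ℝ ∞ f ∧ ∀ h : ℝ, 0 < h → ∃ C : ℝ, ∀ (x : X) (n : ℕ),
    ‖iteratedFDeriv ℝ n f x‖ ≤ C * (h ^ n * (n ! : ℝ) ^ s)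

namespace IsUniformGevrey

variable {s : ℝ} {f g : X → ℂ}

theorem const (c : ℂ) : IsUniformGevrey s (fun _ : X => c) := by
  refine ⟨contDiff_const, fun h hh => ⟨‖c‖, fun x n => ?_⟩⟩
  cases n with
  | zero => simp
  | succ n => simp only [iteratedFDeriv_const_of_ne n.succ_ne_zero, Pi.zero_apply, norm_zero]
              positivity

theorem mul (hs : 0 ≤ s) (hf : IsUniformGevrey s f) (hg : IsUniformGevrey s g) :
    IsUniformGevrey s (fun x => f x * g x) := by
  refine ⟨hf.1.mul hg.1, fun h hh => ?_⟩
  obtain ⟨A, hA⟩ := hf.2 (h / 2) (by positivity)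
  obtain ⟨B, hB⟩ := hg.2 (h / 2) (by positivity)
  refine ⟨A * B, fun x n => ?_⟩
  have hA0 : 0 ≤ A := by simpa using (norm_nonneg _).trans (hA x 0)
  have h1 := mul_norm_iteratedFDeriv_mul_le hs hf.1 hg.1 (k := h / 2) (V := 1) (W := 1)
    (by positivity) zero_le_one zero_le_one hA0
    (fun n => by rw [one_mul]; exact hA x n) (fun n => by rw [one_mul]; exact hB x n) n
  have h2 : 2 * (h / 2) = h := by ring
  rwa [one_mul, one_mul, h2] at h1

theorem prod (hs : 0 ≤ s) {ι : Type*} (S : Finset ι) {F : ι → X → ℂ}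
    (hF : ∀ i, IsUniformGevrey s (F i)) : IsUniformGevrey s (fun x => ∏ i ∈ S, F i x) := by
  classical
  induction S using Finset.induction with
  | empty => simpa using const 1
  | insert i S hi ih =>
    simp only [Finset.prod_insert hi]
    exact (hF i).mul hs ih

theorem comp_affine {Y : Type*} [NormedAddCommGroup Y] [NormedSpace ℝ Y]
    (hf : IsUniformGevrey s f) (L : Y →L[ℝ] X) (c : X) :
    IsUniformGevrey s (fun y => f (L y + c)) := by
  have hfc : ContDiff ℝ ∞ (fun x => f (x + c)) := hf.1.comp (contDiff_id.add contDiff_const)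
  refine ⟨hfc.comp L.contDiff, fun h hh => ?_⟩
  -- The linear map costs `‖L‖ ^ n`, which the freedom in `h` absorbs; the added `1` covers `L = 0`.
  obtain ⟨C, hC⟩ := hf.2 (h / (‖L‖ + 1)) (by positivity)
  refine ⟨C, fun y n => ?_⟩
  have hC0 : 0 ≤ C := by simpa using (norm_nonneg _).trans (hC 0 0)
  change ‖iteratedFDeriv ℝ n ((fun x => f (x + c)) ∘ L) y‖ ≤ _
  rw [L.iteratedFDeriv_comp_right hfc y (i := n) (by exact_mod_cast le_top),
    iteratedFDeriv_comp_add_right]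
  refine (ContinuousMultilinearMap.norm_compContinuousLinearMap_le _ _).trans ?_
  rw [Finset.prod_const, Finset.card_univ, Fintype.card_fin]
  calc ‖iteratedFDeriv ℝ n f (L y + c)‖ * ‖L‖ ^ n
      ≤ C * ((h / (‖L‖ + 1)) ^ n * (n ! : ℝ) ^ s) * (‖L‖ + 1) ^ n := by
        gcongr
        · exact hC _ _
        · linarith
    _ = C * ((h / (‖L‖ + 1) * (‖L‖ + 1)) ^ n * (n ! : ℝ) ^ s) := by rw [mul_pow]; ring
    _ = _ := by rw [div_mul_cancel₀ _ (by positivity)]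

end IsUniformGevrey

end Product

theorem IsUniformGevrey.isGevrey {d : ℕ} {s : ℝ} (hs : 0 ≤ s) {f : E d → ℂ}
    (hf : IsUniformGevrey s f) : IsGevrey s f := by
  refine ⟨hf.1, fun K _ h hh => ?_⟩
  obtain ⟨C, hC⟩ := hf.2 (h / ((d : ℝ) + 1) ^ s) (by positivity)
  refine ⟨C, fun x _ β => ?_⟩
  have hC0 : 0 ≤ C := by simpa using (norm_nonneg _).trans (hC 0 0)
  have h1 := multi_le_of_norm hs hf.1 zero_le_one hC0 (k := h / ((d : ℝ) + 1) ^ s)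
    (by positivity) (x := x) (fun n => by rw [one_mul]; exact hC x n) β
  have h2 : ((d : ℝ) + 1) ^ s * (h / ((d : ℝ) + 1) ^ s) = h := by field_simp
  rwa [one_mul, h2] at h1

/-- Only the estimates with `α = 0` are needed. The factor `(d + 1)^n` lost between multi-indices
and Fréchet derivatives is absorbed in `h`. -/
theorem MemGS.isUniformGevrey {d : ℕ} {t s : ℝ} (hs : 0 ≤ s) {f : E d → ℂ} (hf : MemGS t s f) :
    IsUniformGevrey s f := by
  refine ⟨hf.1, fun h hh => ?_⟩
  obtain ⟨C, hC⟩ := hf.2 (h / ((d : ℝ) + 1)) (by positivity)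
  refine ⟨C, fun x n => ?_⟩
  have h1 := norm_le_of_multi hs hf.1 zero_le_one (nonneg_of_bound (by positivity) hC)
    (k := h / ((d : ℝ) + 1)) (by positivity) (x := x)
    (fun β => by simpa [mpow, gsWeight, mlen, mfact] using hC 0 β x) n
  have h2 : ((d : ℝ) + 1) * (h / ((d : ℝ) + 1)) = h := by field_simp
  rwa [one_mul, h2] at h1

end GelfandShilovWF

namespace GelfandShilovWF

/-! ### Compactly supported Gevrey functions -/

/-- The holomorphic function extending `x ↦ exp (-x ^ (-m))`. -/
noncomputable def expNegInvPow (m : ℕ) (z : ℂ) : ℂ := Complex.exp (-(z ^ m)⁻¹)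

theorem differentiableAt_expNegInvPow (m : ℕ) {z : ℂ} (hz : z ≠ 0) :
    DifferentiableAt ℂ (expNegInvPow m) z :=
  (((differentiableAt_id.pow m).inv (pow_ne_zero m hz)).neg).cexp

/-- Applied with `z = x (1 + w)`, this gives `Re z^{-m} ≥ x^{-m} / 2` on the disc of radius `c x`
about `x > 0`; the condition `c < 1` keeps that disc away from the singularity at `0`. -/
theorem exists_re_inv_pow_ge (m : ℕ) : ∃ c : ℝ, 0 < c ∧ c < 1 ∧
    ∀ w : ℂ, ‖w‖ ≤ c → 1 / 2 ≤ (((1 + w) ^ m)⁻¹).re := by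
  have h1 : ContinuousAt (fun w : ℂ => (((1 + w) ^ m)⁻¹).re) 0 := by
    refine Complex.continuous_re.continuousAt.comp ?_
    exact ((continuous_const.add continuous_id).pow m).continuousAt.inv₀ (by simp)
  have h2 : ∀ᶠ w : ℂ in nhds 0, 1 / 2 < (((1 + w) ^ m)⁻¹).re :=
    h1.eventually (lt_mem_nhds (by norm_num))
  obtain ⟨ε, hε, h⟩ := Metric.eventually_nhds_iff.mp h2
  refine ⟨min (ε / 2) (1 / 2), by positivity, (min_le_right _ _).trans_lt (by norm_num), ?_⟩
  intro w hw
  refine (h ?_).le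
  rw [dist_zero_right]
  have := hw.trans (min_le_left _ _)
  linarith

/-- Cauchy's estimate on the circle of radius `c x` about `x` gives `n! (c x)^{-n} exp(-x^{-m}/2)`.
The exponential compensates `x^{-n}` at the cost of `n!^{1/m}`, uniformly in `x`. -/
theorem exists_norm_iteratedDeriv_expNegInvPow_le {m : ℕ} (hm : 0 < m) :
    ∃ k : ℝ, 0 < k ∧ ∀ x : ℝ, 0 < x → ∀ n : ℕ,
      ‖iteratedDeriv n (expNegInvPow m) x‖ ≤ k ^ n * (n ! : ℝ) ^ (1 + 1 / (m : ℝ)) := by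
  obtain ⟨c, hc, hc1, hre⟩ := exists_re_inv_pow_ge m
  have hm' : (0 : ℝ) < m := by exact_mod_cast hm
  -- This `b` makes the exponent `(1/m) (x⁻¹/b)^m` of `pow_le_exp_mul_factorial` equal to
  -- `x^{-m}/2`, cancelling the bound from the circle exactly.
  set b : ℝ := (2 / m) ^ (1 / (m : ℝ)) with hb
  have hb0 : 0 < b := by positivity
  refine ⟨b / c, by positivity, fun x hx n => ?_⟩
  have hne : ∀ z ∈ Metric.closedBall (x : ℂ) (c * x), z ≠ 0 := by
    rintro z hz rfl
    rw [Metric.mem_closedBall, dist_comm, dist_zero_right, Complex.norm_real, Real.norm_eq_abs,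
      abs_of_pos hx] at hz
    nlinarith
  have hcx : 0 < c * x := by positivity
  have hd : DiffContOnCl ℂ (expNegInvPow m) (Metric.ball (x : ℂ) (c * x)) := by
    refine DifferentiableOn.diffContOnCl fun z hz => ?_
    rw [closure_ball _ hcx.ne'] at hz
    exact (differentiableAt_expNegInvPow m (hne z hz)).differentiableWithinAt
  have hbd : ∀ z ∈ Metric.sphere (x : ℂ) (c * x),
      ‖expNegInvPow m z‖ ≤ Real.exp (-((x⁻¹) ^ m / 2)) := by
    intro z hz
    have hxc : (x : ℂ) ≠ 0 := by exact_mod_cast hx.ne'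
    have hz' : z = x * (1 + (z - x) / x) := by field_simp; ring
    have hw : ‖(z - x) / (x : ℂ)‖ ≤ c := by
      rw [mem_sphere_iff_norm] at hz
      rw [norm_div, hz, Complex.norm_real, Real.norm_eq_abs, abs_of_pos hx,
        mul_div_cancel_right₀ _ hx.ne']
    have h1 := hre _ hw
    rw [expNegInvPow, Complex.norm_exp, Real.exp_le_exp, Complex.neg_re, neg_le_neg_iff]
    have h2 : ((z ^ m)⁻¹ : ℂ) = (((x⁻¹) ^ m : ℝ) : ℂ) * ((1 + (z - x) / x) ^ m)⁻¹ := by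
      conv_lhs => rw [hz']
      rw [mul_pow, mul_inv]
      push_cast
      rw [inv_pow]
    rw [h2, Complex.re_ofReal_mul]
    have : 0 < (x⁻¹) ^ m := by positivity
    nlinarith
  have h1 := Complex.norm_iteratedDeriv_le_of_forall_mem_sphere_norm_le n hcx hd hbd
  have h2 := pow_le_exp_mul_factorial (σ := 1 / (m : ℝ)) (by positivity) (R := x⁻¹)
    (by positivity) hb0 n
  have h3 : 1 / (m : ℝ) * (x⁻¹ / b) ^ (1 / (1 / (m : ℝ))) = (x⁻¹) ^ m / 2 := by
    rw [one_div_one_div, Real.rpow_natCast, div_pow, hb, ← Real.rpow_natCast (_ ^ _),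
      ← Real.rpow_mul (by positivity), one_div_mul_cancel hm'.ne', Real.rpow_one]
    field_simp
  rw [h3] at h2
  calc ‖iteratedDeriv n (expNegInvPow m) x‖
      ≤ (n ! : ℝ) * Real.exp (-((x⁻¹) ^ m / 2)) / (c * x) ^ n := h1
    _ = (n ! : ℝ) * Real.exp (-((x⁻¹) ^ m / 2)) * (c⁻¹ ^ n * (x⁻¹) ^ n) := by
        rw [div_eq_mul_inv, mul_pow, mul_inv, inv_pow c, inv_pow x n]
    _ ≤ (n ! : ℝ) * Real.exp (-((x⁻¹) ^ m / 2)) * (c⁻¹ ^ n *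
        (Real.exp ((x⁻¹) ^ m / 2) * (b ^ n * (n ! : ℝ) ^ (1 / (m : ℝ))))) := by gcongr
    _ = (Real.exp (-((x⁻¹) ^ m / 2)) * Real.exp ((x⁻¹) ^ m / 2)) * ((b * c⁻¹) ^ n *
        ((n ! : ℝ) * (n ! : ℝ) ^ (1 / (m : ℝ)))) := by rw [mul_pow]; ring
    _ = (b / c) ^ n * (n ! : ℝ) ^ (1 + 1 / (m : ℝ)) := by
        rw [← Real.exp_add, neg_add_cancel, Real.exp_zero, one_mul,
          Real.rpow_add (by positivity), Real.rpow_one]; rfl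

/-- The smooth function equal to `exp (-x ^ (-m))` for `x > 0` and, if `m` is odd, to zero for
`x ≤ 0`. -/
noncomputable def expNegInvPowGlue (m : ℕ) (x : ℝ) : ℂ := (expNegInvGlue (x ^ m) : ℂ)

theorem contDiff_expNegInvPowGlue (m : ℕ) : ContDiff ℝ ∞ (expNegInvPowGlue m) :=
  Complex.ofRealCLM.contDiff.comp (expNegInvGlue.contDiff.comp (contDiff_id.pow m))

theorem expNegInvPowGlue_of_nonpos {m : ℕ} (hm : Odd m) {x : ℝ} (hx : x ≤ 0) :
    expNegInvPowGlue m x = 0 := by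
  rw [expNegInvPowGlue, expNegInvGlue.zero_of_nonpos (hm.pow_nonpos hx), Complex.ofReal_zero]

theorem expNegInvPowGlue_ne_zero (m : ℕ) {x : ℝ} (hx : 0 < x) : expNegInvPowGlue m x ≠ 0 := by
  rw [expNegInvPowGlue, Complex.ofReal_ne_zero]
  exact (expNegInvGlue.pos_of_pos (pow_pos hx m)).ne'

/-- On the positive axis the real function restricts a holomorphic one, so real and complex
derivatives agree; equality on a neighbourhood carries the induction. -/
theorem iteratedDeriv_expNegInvPowGlue (m n : ℕ) {x : ℝ} (hx : 0 < x) :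
    iteratedDeriv n (expNegInvPowGlue m) x = iteratedDeriv n (expNegInvPow m) x := by
  induction n generalizing x with
  | zero =>
    simp only [iteratedDeriv_zero, expNegInvPowGlue, expNegInvPow, expNegInvGlue]
    rw [if_neg (not_le.mpr (pow_pos hx m))]
    push_cast
    rfl
  | succ n ih =>
    have hxc : (x : ℂ) ≠ 0 := by exact_mod_cast hx.ne'
    have han : AnalyticAt ℂ (expNegInvPow m) x :=
      (DifferentiableOn.analyticOnNhd (s := {0}ᶜ)
        (fun z hz => (differentiableAt_expNegInvPow m hz).differentiableWithinAt)
        isOpen_compl_singleton) _ hxc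
    have hd : DifferentiableAt ℂ (iteratedDeriv n (expNegInvPow m)) x := by
      rw [iteratedDeriv_eq_iterate]; exact (han.iterated_deriv n).differentiableAt
    rw [iteratedDeriv_succ, iteratedDeriv_succ, ← hd.hasDerivAt.comp_ofReal.deriv]
    apply Filter.EventuallyEq.deriv_eq
    filter_upwards [lt_mem_nhds hx] with y hy using ih hy

/-- The function vanishes on the open negative axis. At `0` continuity of the derivatives suffices,
so no estimate is needed there. -/
theorem iteratedDeriv_expNegInvPowGlue_of_nonpos {m : ℕ} (hm : Odd m) (n : ℕ) {x : ℝ}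
    (hx : x ≤ 0) : iteratedDeriv n (expNegInvPowGlue m) x = 0 := by
  have h1 : Set.EqOn (iteratedDeriv n (expNegInvPowGlue m)) 0 (Set.Iio 0) := by
    intro y hy
    have h2 : expNegInvPowGlue m =ᶠ[nhds y] fun _ => 0 := by
      filter_upwards [gt_mem_nhds hy] with z hz using expNegInvPowGlue_of_nonpos hm hz.le
    rw [h2.iteratedDeriv_eq]
    simp
  have h3 := h1.closure ((contDiff_expNegInvPowGlue m).continuous_iteratedDeriv n
    (by exact_mod_cast le_top)) continuous_const
  rw [closure_Iio] at h3
  exact h3 hx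

/-- The order `1 + 1/m` is strictly below `s` for large `m`, and this gap upgrades an estimate with
one constant `k` to estimates with every `h > 0`. Taking `m` odd makes `x^m ≤ 0` for `x ≤ 0`. -/
theorem exists_isUniformGevrey_glue {s : ℝ} (hs : 1 < s) : ∃ f : ℝ → ℂ,
    IsUniformGevrey s f ∧ (∀ x ≤ 0, f x = 0) ∧ ∀ x, 0 < x → f x ≠ 0 := by
  obtain ⟨N, hN⟩ := exists_nat_gt (1 / (s - 1))
  set m := 2 * N + 1 with hm_def
  have hm : Odd m := ⟨N, rfl⟩
  have hs0 : 0 < s - 1 := by linarith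
  have hm0 : (0 : ℝ) < m := by positivity
  have hms : 0 < s - (1 + 1 / (m : ℝ)) := by
    have h1 : 1 / (s - 1) < m := hN.trans_le (by push_cast [hm_def]; linarith [N.cast_nonneg (α := ℝ)])
    rw [div_lt_comm₀ hs0 hm0] at h1
    linarith
  refine ⟨expNegInvPowGlue m, ⟨contDiff_expNegInvPowGlue m, fun h hh => ?_⟩,
    fun x hx => expNegInvPowGlue_of_nonpos hm hx, fun x hx => expNegInvPowGlue_ne_zero m hx⟩
  obtain ⟨k, hk, hkb⟩ := exists_norm_iteratedDeriv_expNegInvPow_le (m := m) (by omega)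
  -- The surplus power `n!^{s - (1 + 1/m)}` absorbs `(k/h)^n`.
  obtain ⟨C, hC1, hC⟩ := exists_pow_le hms k hk.le hh
  refine ⟨C, fun x n => ?_⟩
  rw [norm_iteratedFDeriv_eq_norm_iteratedDeriv]
  rcases le_or_gt x 0 with hx | hx
  · rw [iteratedDeriv_expNegInvPowGlue_of_nonpos hm n hx, norm_zero]; positivity
  · rw [iteratedDeriv_expNegInvPowGlue m n hx]
    calc ‖iteratedDeriv n (expNegInvPow m) x‖ ≤ k ^ n * (n ! : ℝ) ^ (1 + 1 / (m : ℝ)) := hkb x hx n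
      _ ≤ C * (h ^ n * (n ! : ℝ) ^ (s - (1 + 1 / (m : ℝ)))) *
          (n ! : ℝ) ^ (1 + 1 / (m : ℝ)) := by gcongr; exact hC n
      _ = C * (h ^ n * ((n ! : ℝ) ^ (s - (1 + 1 / (m : ℝ))) *
          (n ! : ℝ) ^ (1 + 1 / (m : ℝ)))) := by ring
      _ = _ := by rw [← Real.rpow_add (by positivity), sub_add_cancel]

/-- Compactly supported Gevrey functions of order `s > 1` which do not vanish at a given point. -/
theorem exists_isUniformGevrey_bump (d : ℕ) {s : ℝ} (hs : 1 < s) (x₀ : E d) : ∃ g : E d → ℂ,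
    IsUniformGevrey s g ∧ HasCompactSupport g ∧ g x₀ ≠ 0 := by
  obtain ⟨f, hf, hf0, hf1⟩ := exists_isUniformGevrey_glue hs
  have hs0 : 0 ≤ s := by linarith
  let L : Fin d → E d →L[ℝ] ℝ := fun j => EuclideanSpace.proj j
  -- The `j`-th factor is nonzero exactly when `|y_j - x₀_j| < 1`, so the support lies in a cube
  -- about `x₀`, hence in the ball of radius `√d`.
  refine ⟨fun y => ∏ j, (f (L j y + (1 - x₀ j)) * f ((-L j) y + (1 + x₀ j))), ?_, ?_, ?_⟩
  · exact IsUniformGevrey.prod hs0 _ fun j =>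
      (hf.comp_affine (L j) _).mul hs0 (hf.comp_affine (-L j) _)
  · refine HasCompactSupport.of_support_subset_isCompact
      (isCompact_closedBall x₀ (Real.sqrt d)) fun y hy => ?_
    rw [Function.mem_support, Finset.prod_ne_zero_iff] at hy
    rw [mem_closedBall_iff_norm, EuclideanSpace.norm_eq]
    refine Real.sqrt_le_sqrt ?_
    have h1 : ∀ j, ‖(y - x₀) j‖ ^ 2 ≤ 1 := by
      intro j
      have h2 := hy j (Finset.mem_univ j)
      have h3 : 0 < y j + (1 - x₀ j) := by
        by_contra h
        exact h2 (by rw [show L j y = y j from rfl, hf0 _ (not_lt.mp h), zero_mul])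
      have h4 : 0 < -y j + (1 + x₀ j) := by
        by_contra h
        exact h2 (by rw [show (-L j) y = -y j from rfl, hf0 _ (not_lt.mp h), mul_zero])
      rw [Real.norm_eq_abs, sq_abs, PiLp.sub_apply]
      nlinarith
    calc ∑ j, ‖(y - x₀) j‖ ^ 2 ≤ ∑ _j : Fin d, (1 : ℝ) := Finset.sum_le_sum fun j _ => h1 j
      _ = d := by simp
  · refine Finset.prod_ne_zero_iff.mpr fun j _ => mul_ne_zero (hf1 _ ?_) (hf1 _ ?_)
    · change 0 < x₀ j + (1 - x₀ j); linarith
    · change 0 < -x₀ j + (1 + x₀ j); linarith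

/-! ### Decay of Fourier transforms -/

-- Compact support turns the uniform bounds on derivatives into bounds on their `L¹` norms. These
-- control `‖w‖^n ‖𝓕 g w‖` by `k^n n!^s` for any `k > 0`, and `exp_mul_le_of_pow_mul_le` converts
-- this into decay at any rate `ρ`.
open FourierTransform MeasureTheory in
theorem norm_fourier_le {d : ℕ} {s : ℝ} (hs : 0 < s) {g : E d → ℂ} (hg : IsUniformGevrey s g)
    (hgc : HasCompactSupport g) (ρ : ℝ) :
    ∃ C : ℝ, 0 ≤ C ∧ ∀ w : E d, ‖𝓕 g w‖ ≤ C * Real.exp (-(ρ * ‖w‖ ^ (1 / s))) := by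
  wlog hρ : 0 ≤ ρ generalizing ρ
  · obtain ⟨C, hC, h⟩ := this 0 le_rfl
    refine ⟨C, hC, fun w => (h w).trans ?_⟩
    gcongr
    nlinarith [Real.rpow_nonneg (norm_nonneg w) (1 / s)]
  obtain ⟨k, hk, hρk⟩ : ∃ k : ℝ, 0 < k ∧ ρ / s * k ^ (1 / s) ≤ 1 / 2 := by
    -- With this `k` the quantity to be bounded is `ρ / (2 (ρ + 1))`.
    refine ⟨(s / (2 * (ρ + 1))) ^ s, by positivity, ?_⟩
    rw [← Real.rpow_mul (by positivity), mul_one_div_cancel hs.ne', Real.rpow_one]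
    rw [div_mul_div_comm, div_le_iff₀ (by positivity)]
    nlinarith
  have hint : ∀ n : ℕ, Integrable (fun v : E d => ‖iteratedFDeriv ℝ n g v‖) := by
    intro n
    refine (Continuous.integrable_of_hasCompactSupport
      (hg.1.continuous_iteratedFDeriv (by exact_mod_cast le_top)) (hgc.iteratedFDeriv n)).norm
  set V : ℝ := volume.real (tsupport g)
  -- The divisor `4` pays for the constant `2^n` in the Fourier estimate and for a sum of `n + 1 ≤
  -- 2^n` terms.
  obtain ⟨C, hC⟩ := hg.2 (k / 4) (by positivity)
  have hC0 : 0 ≤ C := by simpa using (norm_nonneg _).trans (hC 0 0)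
  -- Since `k/4` may be small, `1 ≤ D (k/4)^{n-i} (n-i)!^s` is used to raise the bound for the
  -- `i`-th derivative to order `n`.
  obtain ⟨D, hD1, hD⟩ := exists_pow_le hs 1 zero_le_one (k := k / 4) (by positivity)
  have hD0 : 0 ≤ D := by linarith
  have hbd : ∀ n : ℕ, ∫ v : E d, ‖iteratedFDeriv ℝ n g v‖ ≤
      V * (C * ((k / 4) ^ n * (n ! : ℝ) ^ s)) := by
    intro n
    have h1 : ∫ v : E d, ‖iteratedFDeriv ℝ n g v‖ =
        ∫ v in tsupport g, ‖iteratedFDeriv ℝ n g v‖ := by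
      rw [setIntegral_eq_integral_of_forall_compl_eq_zero]
      intro v hv
      rw [norm_eq_zero]
      by_contra h
      exact hv (support_iteratedFDeriv_subset (𝕜 := ℝ) n h)
    rw [h1]
    have h2 := norm_setIntegral_le_of_norm_le_const (μ := volume) (s := tsupport g)
      (f := fun v => ‖iteratedFDeriv ℝ n g v‖) (C := C * ((k / 4) ^ n * (n ! : ℝ) ^ s))
      hgc.isCompact.measure_lt_top (fun v _ => by rw [norm_norm]; exact hC v n)
    rw [mul_comm]
    exact (le_abs_self _).trans h2
  have key : ∀ (w : E d) (n : ℕ), ‖w‖ ^ n * ‖𝓕 g w‖ ≤ (V * C * D) * (k ^ n * (n ! : ℝ) ^ s) := by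
    intro w n
    have h1 := Real.pow_mul_norm_iteratedFDeriv_fourier_le (f := g) (K := 0) (N := ⊤) hg.1
      (fun i n hi _ => by
        have : i = 0 := by simpa using hi
        subst this
        simpa using hint n) (k := 0) (n := n) (by simp) le_top w
    rw [norm_iteratedFDeriv_zero] at h1
    refine h1.trans ?_
    have h2 : ∑ p ∈ Finset.range (0 + 1) ×ˢ Finset.range (n + 1),
        ∫ v : E d, ‖v‖ ^ p.1 * ‖iteratedFDeriv ℝ p.2 g v‖ =
        ∑ i ∈ Finset.range (n + 1), ∫ v : E d, ‖iteratedFDeriv ℝ i g v‖ := by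
      rw [Finset.sum_product]; simp
    rw [h2]
    have h3 : ∀ i ∈ Finset.range (n + 1), ∫ v : E d, ‖iteratedFDeriv ℝ i g v‖ ≤
        V * C * D * ((k / 4) ^ n * (n ! : ℝ) ^ s) := by
      intro i hi
      have hin : i ≤ n := Nat.lt_succ_iff.mp (Finset.mem_range.mp hi)
      have h4 := hD (n - i)
      rw [one_pow] at h4
      have hkn : (k / 4) ^ i * (k / 4) ^ (n - i) = (k / 4) ^ n := by
        rw [← pow_add]; congr 1; omega
      have hV : 0 ≤ V := measureReal_nonneg
      calc ∫ v : E d, ‖iteratedFDeriv ℝ i g v‖ ≤ V * (C * ((k / 4) ^ i * (i ! : ℝ) ^ s)) := hbd i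
        _ = V * (C * ((k / 4) ^ i * (i ! : ℝ) ^ s)) * 1 := by ring
        _ ≤ V * (C * ((k / 4) ^ i * (i ! : ℝ) ^ s)) *
            (D * ((k / 4) ^ (n - i) * ((n - i)! : ℝ) ^ s)) := by gcongr
        _ = V * C * D * (((k / 4) ^ i * (k / 4) ^ (n - i)) *
            ((i ! : ℝ) ^ s * ((n - i)! : ℝ) ^ s)) := by ring
        _ ≤ _ := by rw [hkn]; gcongr; exact factorial_rpow_mul_le hs.le hin
    have h5 : ((n + 1 : ℕ) : ℝ) ≤ 2 ^ n := by exact_mod_cast Nat.lt_two_pow_self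
    have hV : 0 ≤ V := measureReal_nonneg
    calc (2 * Real.pi) ^ 0 * (2 * ((0 : ℕ) : ℝ) + 2) ^ n *
          ∑ i ∈ Finset.range (n + 1), ∫ v : E d, ‖iteratedFDeriv ℝ i g v‖
        ≤ (2 * Real.pi) ^ 0 * (2 * ((0 : ℕ) : ℝ) + 2) ^ n *
          ∑ i ∈ Finset.range (n + 1), V * C * D * ((k / 4) ^ n * (n ! : ℝ) ^ s) := by
          gcongr with i hi; exact h3 i hi
      _ = 2 ^ n * (((n + 1 : ℕ) : ℝ) * (V * C * D * ((k / 4) ^ n * (n ! : ℝ) ^ s))) := by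
          simp
      _ ≤ 2 ^ n * (2 ^ n * (V * C * D * ((k / 4) ^ n * (n ! : ℝ) ^ s))) := by gcongr
      _ = (V * C * D) * ((2 * 2 * (k / 4)) ^ n * (n ! : ℝ) ^ s) := by rw [mul_pow, mul_pow]; ring
      _ = _ := by congr 3; ring
  have hV : 0 ≤ V := measureReal_nonneg
  refine ⟨2 ^ s * (V * C * D), by positivity, fun w => ?_⟩
  have h1 := exp_mul_le_of_pow_mul_le hs (norm_nonneg w) (norm_nonneg (𝓕 g w))
    (C := V * C * D) (by positivity) hk hρ hρk (key w)
  rw [Real.exp_neg, ← div_eq_mul_inv, le_div_iff₀ (Real.exp_pos _)]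
  linarith

-- By `pow_le_exp_mul_factorial` and subadditivity of the power `1/s ≤ 1`, the exponential with `ρ =
-- s` is dominated by a multiple of `(1 + ‖w‖)^{-(d+1)}`.
open MeasureTheory in
theorem exists_integrable_exp_neg_norm_rpow (d : ℕ) {s : ℝ} (hs : 1 ≤ s) : ∃ ρ : ℝ,
    Integrable (fun w : E d => Real.exp (-(ρ * ‖w‖ ^ (1 / s)))) := by
  have hs0 : 0 < s := by linarith
  refine ⟨s, Integrable.mono' ((integrable_one_add_norm (E := E d) (μ := volume)
    (r := ((d + 1 : ℕ) : ℝ)) (by simp)).const_mul (Real.exp s * ((d + 1)! : ℝ) ^ s)) ?_ ?_⟩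
  · have hc : Continuous fun w : E d => ‖w‖ ^ (1 / s) :=
      continuous_norm.rpow_const fun _ => Or.inr (by positivity)
    exact (Real.continuous_exp.comp (continuous_const.mul hc).neg).aestronglyMeasurable
  · refine Filter.Eventually.of_forall fun w => ?_
    have h1 := pow_le_exp_mul_factorial hs0 (R := 1 + ‖w‖) (by positivity) one_pos (d + 1)
    have h2 : (1 + ‖w‖) ^ (1 / s) ≤ 1 + ‖w‖ ^ (1 / s) := by
      have := Real.rpow_add_le_add_rpow zero_le_one (norm_nonneg w) (p := 1 / s) (by positivity)
        (by rw [div_le_one hs0]; exact hs)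
      rwa [Real.one_rpow] at this
    rw [div_one, one_pow, one_mul] at h1
    rw [Real.norm_of_nonneg (Real.exp_pos _).le, Real.rpow_neg (by positivity), Real.rpow_natCast,
      Real.exp_neg, ← div_eq_mul_inv, le_div_iff₀ (by positivity), inv_mul_le_iff₀ (by positivity)]
    calc (1 + ‖w‖) ^ (d + 1) ≤ Real.exp (s * (1 + ‖w‖) ^ (1 / s)) * ((d + 1)! : ℝ) ^ s := h1
      _ ≤ Real.exp (s * (1 + ‖w‖ ^ (1 / s))) * ((d + 1)! : ℝ) ^ s := by gcongr
      _ = _ := by rw [mul_add, Real.exp_add, mul_one]; ring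

end GelfandShilovWF

namespace GelfandShilovWF

/-! ### Multiplication and modulation in Gelfand–Shilov spaces -/

/-- The multiplier may grow like `v` if `f` has decay `1/v` to spare: the Leibniz weights `1/v` and
`v |x^α|` multiply to `|x^α|`. In `k`, the factor `d + 1` pays for passing to Fréchet derivatives,
`2` for Leibniz' rule and `(d + 1)^s` for returning to multi-indices. -/
theorem gs_mul_le {d : ℕ} {t s h : ℝ} (hs : 0 < s) (hh : 0 < h) {k : ℝ}
    (hk : k = h / (((d : ℝ) + 1) ^ s * (2 * ((d : ℝ) + 1)))) {a f : E d → ℂ}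
    (ha : ContDiff ℝ ∞ a) (hf : ContDiff ℝ ∞ f) {v : E d → ℝ} (hv : ∀ x, 0 < v x) {A B : ℝ}
    (hA0 : 0 ≤ A) (hB0 : 0 ≤ B)
    (hA : ∀ (x : E d) (n : ℕ),
      ‖iteratedFDeriv ℝ n a x‖ ≤ A * v x * ((((d : ℝ) + 1) * k) ^ n * (n ! : ℝ) ^ s))
    (hB : ∀ (α β : Fin d → ℕ) (x : E d),
      v x * |mpow x α| * ‖mderiv β f x‖ ≤ B * gsWeight t s k α β) (α β : Fin d → ℕ) (x : E d) :
    |mpow x α| * ‖mderiv β (fun y => a y * f y) x‖ ≤ A * B * gsWeight t s h α β := by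
  have hD1 : 1 ≤ (d : ℝ) + 1 := by simp
  have hDs : 1 ≤ ((d : ℝ) + 1) ^ s := Real.one_le_rpow hD1 hs.le
  have hk0 : 0 < k := by rw [hk]; positivity
  have hkh : k ≤ h := by rw [hk]; exact div_le_self hh.le (by nlinarith)
  have hα := mfact_pos α
  have hβ := mfact_pos β
  have h1 : ∀ n : ℕ, v x * |mpow x α| * ‖iteratedFDeriv ℝ n f x‖ ≤
      B * (k ^ mlen α * (mfact α : ℝ) ^ t) * ((((d : ℝ) + 1) * k) ^ n * (n ! : ℝ) ^ s) :=
    norm_le_of_multi hs.le hf (by have := hv x; positivity) (by positivity) hk0 fun β => by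
      have := hB α β x
      rw [gsWeight_split] at this
      linarith
  have h2 : ∀ n : ℕ, (v x)⁻¹ * ‖iteratedFDeriv ℝ n a x‖ ≤
      A * ((((d : ℝ) + 1) * k) ^ n * (n ! : ℝ) ^ s) := by
    intro n
    rw [inv_mul_le_iff₀ (hv x)]
    exact (hA x n).trans (le_of_eq (by ring))
  have h3 := mul_norm_iteratedFDeriv_mul_le hs.le ha hf (k := ((d : ℝ) + 1) * k) (by positivity)
    (by have := hv x; positivity) (inv_nonneg.mpr (hv x).le) hA0 h2 h1
  have h4 : (v x)⁻¹ * (v x * |mpow x α|) = |mpow x α| := by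
    rw [← mul_assoc, inv_mul_cancel₀ (hv x).ne', one_mul]
  rw [h4] at h3
  have h5 := multi_le_of_norm hs.le (ha.mul hf) (abs_nonneg _) (by positivity) (by positivity) h3 β
  have h6 : ((d : ℝ) + 1) ^ s * (2 * (((d : ℝ) + 1) * k)) = h := by rw [hk]; field_simp
  rw [h6] at h5
  refine h5.trans ?_
  rw [gsWeight_split]
  calc A * (B * (k ^ mlen α * (mfact α : ℝ) ^ t)) * (h ^ mlen β * (mfact β : ℝ) ^ s)
      ≤ A * (B * (h ^ mlen α * (mfact α : ℝ) ^ t)) * (h ^ mlen β * (mfact β : ℝ) ^ s) := by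
        gcongr
    _ = _ := by ring

/-- A factor `x_j` only raises `α_j` by one. The resulting `(α_j + 1)^t` is at most `(2^t)^{|α|}`,
which is absorbed by starting from `k / 2^t`. -/
theorem exists_one_add_norm_mul_le {d : ℕ} {t s : ℝ} (ht : 0 < t) {f : E d → ℂ}
    (hf : MemGS t s f) {k : ℝ} (hk : 0 < k) : ∃ B : ℝ, 0 ≤ B ∧ ∀ (α β : Fin d → ℕ) (x : E d),
      (1 + ‖x‖) * |mpow x α| * ‖mderiv β f x‖ ≤ B * gsWeight t s k α β := by
  have h2t : (1 : ℝ) ≤ 2 ^ t := Real.one_le_rpow one_le_two ht.le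
  set c := k / 2 ^ t with hc
  have hc0 : 0 < c := by positivity
  have hck : c ≤ k := div_le_self hk.le h2t
  obtain ⟨C, hC⟩ := hf.2 c hc0
  have hC0 := nonneg_of_bound hc0 hC
  refine ⟨C + d * (C * c), by positivity, fun α β x => ?_⟩
  have hβ := mfact_pos β
  have hα := mfact_pos α
  have hj : ∀ j, |x j| * (|mpow x α| * ‖mderiv β f x‖) ≤ C * c * gsWeight t s k α β := by
    intro j
    have h1 := hC (α + Pi.single j 1) β x
    have h2 : mpow x (α + Pi.single j 1) = mpow x α * x j := by
      unfold mpow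
      simp only [Pi.add_apply, pow_add, Finset.prod_mul_distrib]
      congr 1
      rw [Finset.prod_eq_single j] <;> simp +contextual
    have h3 : mlen (α + Pi.single j 1) = mlen α + 1 := by
      unfold mlen
      simp [Finset.sum_add_distrib]
    have h4 : mfact (α + Pi.single j 1) = (α j + 1) * mfact α := by
      unfold mfact
      rw [← Finset.mul_prod_erase _ _ (Finset.mem_univ j),
        ← Finset.mul_prod_erase Finset.univ (fun i => (α i)!) (Finset.mem_univ j), ← mul_assoc]
      congr 1
      · simp [Nat.factorial_succ]
      · refine Finset.prod_congr rfl fun i hi => ?_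
        simp [Finset.ne_of_mem_erase hi]
    have h5 : ((α j + 1 : ℕ) : ℝ) ≤ 2 ^ mlen α := by
      have h6 : α j ≤ mlen α := Finset.single_le_sum (f := α) (fun _ _ => Nat.zero_le _)
        (Finset.mem_univ j)
      exact_mod_cast (Nat.succ_le_succ h6).trans Nat.lt_two_pow_self
    have h7 : ((α j + 1 : ℕ) : ℝ) ^ t ≤ (2 ^ t) ^ mlen α := by
      calc ((α j + 1 : ℕ) : ℝ) ^ t ≤ (2 ^ mlen α) ^ t := by gcongr
        _ = (2 ^ t) ^ mlen α := (Real.rpow_pow_comm zero_le_two _ _).symm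
    have h8 : (2 ^ t) * c = k := by rw [hc]; field_simp
    rw [h2, abs_mul, gsWeight_split, h3, h4, Nat.cast_mul,
      Real.mul_rpow (by positivity) hα.le] at h1
    calc |x j| * (|mpow x α| * ‖mderiv β f x‖) = |mpow x α| * |x j| * ‖mderiv β f x‖ := by ring
      _ ≤ _ := h1
      _ ≤ C * ((c ^ (mlen α + 1) * ((2 ^ t) ^ mlen α * (mfact α : ℝ) ^ t)) *
          (k ^ mlen β * (mfact β : ℝ) ^ s)) := by gcongr
      _ = C * c * (((2 ^ t * c) ^ mlen α * (mfact α : ℝ) ^ t) *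
          (k ^ mlen β * (mfact β : ℝ) ^ s)) := by rw [pow_succ, mul_pow]; ring
      _ = _ := by rw [h8, gsWeight_split]
  have hx : ‖x‖ ≤ ∑ j, |x j| := by
    rw [EuclideanSpace.norm_eq, Real.sqrt_le_left (Finset.sum_nonneg fun _ _ => abs_nonneg _)]
    exact Finset.sum_sq_le_sq_sum_of_nonneg fun _ _ => abs_nonneg _
  have hw := gsWeight_mono t s hc0 hck α β
  calc (1 + ‖x‖) * |mpow x α| * ‖mderiv β f x‖
      ≤ (1 + ∑ j, |x j|) * |mpow x α| * ‖mderiv β f x‖ := by gcongr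
    _ = |mpow x α| * ‖mderiv β f x‖ + ∑ j, |x j| * (|mpow x α| * ‖mderiv β f x‖) := by
        rw [← Finset.sum_mul]; ring
    _ ≤ C * gsWeight t s k α β + ∑ _j : Fin d, C * c * gsWeight t s k α β := by
        exact add_le_add ((hC α β x).trans (by gcongr)) (Finset.sum_le_sum fun j _ => hj j)
    _ = _ := by simp; ring

/-- Smallness in `ξ` costs a factor `1 + ‖x‖`. At order zero it comes from `|e^{iθ} - 1| ≤ |θ|`, at
higher orders from `‖ξ‖^n ≤ ‖ξ‖`. -/
theorem norm_iteratedFDeriv_character_sub_one {d : ℕ} {ξ : E d} (hξ : ‖ξ‖ ≤ 1) (n : ℕ) (x : E d) :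
    ‖iteratedFDeriv ℝ n
      (fun y : E d => Complex.exp (Complex.I * ((inner ℝ y ξ : ℝ) : ℂ)) - 1) x‖
      ≤ ‖ξ‖ * (1 + ‖x‖) := by
  cases n with
  | zero =>
    rw [norm_iteratedFDeriv_zero]
    refine (Real.norm_exp_I_mul_ofReal_sub_one_le).trans ?_
    refine (norm_inner_le_norm x ξ).trans ?_
    nlinarith [norm_nonneg ξ]
  | succ n =>
    have h1 : iteratedFDeriv ℝ (n + 1)
        (fun y : E d => Complex.exp (Complex.I * ((inner ℝ y ξ : ℝ) : ℂ)) - 1) x =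
        iteratedFDeriv ℝ (n + 1)
        (fun y : E d => Complex.exp (Complex.I * ((inner ℝ y ξ : ℝ) : ℂ))) x := by
      have h2 := iteratedFDeriv_sub_apply (𝕜 := ℝ) (i := n + 1) (x := x)
        ((contDiff_character ξ).contDiffAt.of_le (by exact_mod_cast le_top))
        (contDiff_const (c := (1 : ℂ))).contDiffAt
      rw [iteratedFDeriv_const_of_ne n.succ_ne_zero, Pi.zero_apply, sub_zero] at h2
      exact h2
    rw [h1]
    refine (norm_iteratedFDeriv_character ξ _ x).trans ?_
    have := pow_le_one₀ (n := n) (norm_nonneg ξ) hξ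
    rw [pow_succ]
    nlinarith [norm_nonneg ξ, norm_nonneg x, mul_nonneg (norm_nonneg ξ) (norm_nonneg x)]

namespace GelfandShilov

variable {d : ℕ} {t s : ℝ}

/-- The growth `exp(r ‖ξ‖^{1/s})` is the price of bounding the derivatives `‖ξ‖^n` of the character
by `c^n n!^s`. -/
theorem seminorm_modulate_le (hs : 0 < s) (h : {h : ℝ // 0 < h}) :
    ∃ (k : {h : ℝ // 0 < h}) (r : ℝ), 0 ≤ r ∧ ∀ (ξ : E d) (f : GelfandShilov d t s),
      seminorm d t s h (f.modulate hs ξ) ≤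
        Real.exp (r * ‖ξ‖ ^ (1 / s)) * seminorm d t s k f := by
  have hh := h.2
  set k : ℝ := h.1 / (((d : ℝ) + 1) ^ s * (2 * ((d : ℝ) + 1))) with hk
  have hk0 : 0 < k := by positivity
  set c : ℝ := ((d : ℝ) + 1) * k
  have hc0 : 0 < c := by positivity
  refine ⟨⟨k, hk0⟩, s * (c ^ (1 / s))⁻¹, by positivity, fun ξ f => seminorm_le h _ ?_⟩
  refine gs_mul_le hs hh hk (contDiff_character ξ) f.mem.1 (v := fun _ => 1)
    (fun _ => one_pos) (by positivity) (apply_nonneg _ _) (fun x n => ?_) fun α β x => ?_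
  · refine (norm_iteratedFDeriv_character ξ n x).trans ?_
    have h1 := pow_le_exp_mul_factorial hs (norm_nonneg ξ) hc0 n
    have h2 : s * (‖ξ‖ / c) ^ (1 / s) = s * (c ^ (1 / s))⁻¹ * ‖ξ‖ ^ (1 / s) := by
      rw [Real.div_rpow (norm_nonneg _) hc0.le]; ring
    rw [h2] at h1
    rwa [mul_one]
  · rw [one_mul]; exact le_seminorm ⟨k, hk0⟩ f α β x

theorem modulate_modulate (hs : 0 < s) (ξ η : E d) (f : GelfandShilov d t s) :
    (f.modulate hs ξ).modulate hs η = f.modulate hs (ξ + η) := by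
  refine GelfandShilov.ext ?_
  funext y
  change Complex.exp _ * (Complex.exp _ * _) = Complex.exp _ * _
  rw [← mul_assoc, ← Complex.exp_add, inner_add_right]
  congr 2
  push_cast
  ring

theorem modulate_sub (hs : 0 < s) (ξ : E d) (f g : GelfandShilov d t s) :
    (f - g).modulate hs ξ = f.modulate hs ξ - g.modulate hs ξ := by
  refine GelfandShilov.ext ?_
  funext y
  change Complex.exp _ * (f.toFun y - g.toFun y) = Complex.exp _ * _ - Complex.exp _ * _
  rw [mul_sub]

theorem seminorm_modulate_sub_le (ht : 0 < t) (hs : 0 < s) (h : {h : ℝ // 0 < h})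
    (f : GelfandShilov d t s) : ∃ C : ℝ, 0 ≤ C ∧ ∀ ξ : E d, ‖ξ‖ ≤ 1 →
      seminorm d t s h (f.modulate hs ξ - f) ≤ C * ‖ξ‖ := by
  have hh := h.2
  set k : ℝ := h.1 / (((d : ℝ) + 1) ^ s * (2 * ((d : ℝ) + 1))) with hk
  have hk0 : 0 < k := by positivity
  obtain ⟨B, hB0, hB⟩ := exists_one_add_norm_mul_le ht f.mem hk0
  obtain ⟨A, hA1, hA⟩ := exists_pow_le hs 1 zero_le_one (k := ((d : ℝ) + 1) * k) (by positivity)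
  have hA0 : 0 ≤ A := by linarith
  refine ⟨A * B, by positivity, fun ξ hξ => seminorm_le h _ ?_⟩
  have h1 : (f.modulate hs ξ - f).toFun =
      fun y => (Complex.exp (Complex.I * ((inner ℝ y ξ : ℝ) : ℂ)) - 1) * f.toFun y := by
    funext y
    change Complex.exp _ * f.toFun y - f.toFun y = _
    ring
  rw [h1]
  have h2 := gs_mul_le hs hh hk ((contDiff_character ξ).sub (contDiff_const (c := 1))) f.mem.1
    (v := fun x => 1 + ‖x‖) (A := ‖ξ‖ * A) (fun x => by positivity) (by positivity) hB0
    (fun x n => ?_) hB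
  · intro α β x
    refine (h2 α β x).trans (le_of_eq (by ring))
  · have h3 := hA n
    rw [one_pow] at h3
    calc _ ≤ ‖ξ‖ * (1 + ‖x‖) := norm_iteratedFDeriv_character_sub_one hξ n x
      _ = ‖ξ‖ * (1 + ‖x‖) * 1 := by ring
      _ ≤ ‖ξ‖ * (1 + ‖x‖) * (A * ((((d : ℝ) + 1) * k) ^ n * (n ! : ℝ) ^ s)) := by gcongr
      _ = _ := by ring

theorem continuous_modulate (ht : 0 < t) (hs : 0 < s) (f : GelfandShilov d t s) :
    Continuous fun ξ : E d => f.modulate hs ξ := by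
  rw [continuous_iff_continuousAt]
  intro ξ₀
  rw [ContinuousAt, (withSeminorms d t s).tendsto_nhds]
  intro h ε hε
  obtain ⟨k, r, -, hk⟩ := seminorm_modulate_le (d := d) (t := t) hs h
  obtain ⟨C, hC0, hC⟩ := seminorm_modulate_sub_le ht hs k f
  set M := Real.exp (r * ‖ξ₀‖ ^ (1 / s)) * C with hM
  have hM0 : 0 ≤ M := by positivity
  have h1 : ∀ᶠ ξ in nhds ξ₀, ‖ξ - ξ₀‖ < min 1 (ε / (M + 1)) := by
    have := Metric.ball_mem_nhds ξ₀ (ε := min 1 (ε / (M + 1))) (by positivity)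
    filter_upwards [this] with ξ hξ using mem_ball_iff_norm.mp hξ
  filter_upwards [h1] with ξ hξ
  -- The group law reduces continuity at `ξ₀` to continuity at `0`.
  have h2 : f.modulate hs ξ - f.modulate hs ξ₀ = (f.modulate hs (ξ - ξ₀) - f).modulate hs ξ₀ := by
    rw [modulate_sub, modulate_modulate, sub_add_cancel]
  rw [h2]
  calc _ ≤ Real.exp (r * ‖ξ₀‖ ^ (1 / s)) * seminorm d t s k (f.modulate hs (ξ - ξ₀) - f) := hk _ _
    _ ≤ Real.exp (r * ‖ξ₀‖ ^ (1 / s)) * (C * ‖ξ - ξ₀‖) := by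
        gcongr; exact hC _ (hξ.le.trans (min_le_left _ _))
    _ = M * ‖ξ - ξ₀‖ := by ring
    _ ≤ M * (ε / (M + 1)) := by gcongr; exact hξ.le.trans (min_le_right _ _)
    _ < ε := by rw [mul_div_assoc', div_lt_iff₀ (by positivity)]; nlinarith

end GelfandShilov

/-! ### Integrals of families of test functions -/

theorem foldr_eq_mderiv {d : ℕ} (l : List (Fin d)) {f : E d → ℂ} (hf : ContDiff ℝ ∞ f) :
    l.foldr pderiv f = mderiv (fun j => l.count j) f := by
  rw [mderiv_eq_foldr]
  refine foldr_perm ?_ hf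
  rw [List.perm_iff_count]
  intro j
  rw [count_dirs]

theorem hasDerivAt_line {d : ℕ} {f : E d → ℂ} (hf : ContDiff ℝ ∞ f) (j : Fin d) (y : E d) (r : ℝ) :
    HasDerivAt (fun r : ℝ => f (y + r • EuclideanSpace.single j (1 : ℝ)))
      (pderiv j f (y + r • EuclideanSpace.single j (1 : ℝ))) r := by
  have h1 : HasDerivAt (fun r : ℝ => y + r • (EuclideanSpace.single j (1 : ℝ) : E d))
      (EuclideanSpace.single j (1 : ℝ)) r := by
    simpa using ((hasDerivAt_id r).smul_const (EuclideanSpace.single j (1 : ℝ) : E d)).const_add y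
  exact ((hf.differentiable (by simp) _).hasFDerivAt).comp_hasDerivAt r h1

-- Differentiation under the integral sign, one coordinate at a time. Because `q` is already known
-- to be smooth, derivatives along lines suffice, and uniqueness of the derivative identifies the
-- result.
open MeasureTheory in
theorem foldr_pderiv_integral {d : ℕ} {Ω : Type*} [MeasurableSpace Ω] {μ : Measure Ω}
    {F : Ω → E d → ℂ} {q : E d → ℂ} (hF : ∀ w, ContDiff ℝ ∞ (F w)) (hq : ContDiff ℝ ∞ q)
    (hFq : ∀ y, q y = ∫ w, F w y ∂μ)
    (hmeas : ∀ (l : List (Fin d)) (y : E d),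
      AEStronglyMeasurable (fun w => l.foldr pderiv (F w) y) μ)
    (hbound : ∀ l : List (Fin d), ∃ b : Ω → ℝ, Integrable b μ ∧
      ∀ w y, ‖l.foldr pderiv (F w) y‖ ≤ b w) (l : List (Fin d)) (y : E d) :
    l.foldr pderiv q y = ∫ w, l.foldr pderiv (F w) y ∂μ := by
  induction l generalizing y with
  | nil => exact hFq y
  | cons j l ih =>
    obtain ⟨b₀, hb₀, hbF₀⟩ := hbound l
    obtain ⟨b, hb, hbF⟩ := hbound (j :: l)
    have h1 := (hasDerivAt_integral_of_dominated_loc_of_deriv_le (μ := μ) (x₀ := (0 : ℝ))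
      (F := fun r w => l.foldr pderiv (F w) (y + r • EuclideanSpace.single j (1 : ℝ)))
      (F' := fun r w => (j :: l).foldr pderiv (F w) (y + r • EuclideanSpace.single j (1 : ℝ)))
      (bound := b) Filter.univ_mem (Filter.Eventually.of_forall fun r => hmeas l _)
      (hb₀.mono' (hmeas l _) (Filter.Eventually.of_forall fun w => hbF₀ w _))
      (hmeas (j :: l) _) (Filter.Eventually.of_forall fun w r _ => hbF w _) hb
      (Filter.Eventually.of_forall fun w r _ =>
        hasDerivAt_line (contDiff_foldr l (hF w)) j y r)).2
    have h2 := hasDerivAt_line (contDiff_foldr l hq) j y 0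
    simp only [← ih] at h1
    have h3 := h2.unique h1
    simpa using h3

/-! ### Embedding into bounded functions and extension of functionals -/

namespace GelfandShilov

variable {d : ℕ} {t s : ℝ}

/-- The index set of the quotients defining the norms of `Σ_t^s(ℝ^d)`. -/
abbrev RatioIndex (d : ℕ) : Type := (Fin d → ℕ) × (Fin d → ℕ) × E d

/-- The embedding of `Σ_t^s(ℝ^d)` into a space of bounded functions given by the quotients defining
the norm with parameter `h`. -/
noncomputable def toLp (h : {h : ℝ // 0 < h}) :
    GelfandShilov d t s →ₗ[ℂ] lp (fun _ : RatioIndex d => ℂ) ⊤ where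
  toFun f := ⟨fun p => ((mpow p.2.2 p.1 / gsWeight t s h.1 p.1 p.2.1 : ℝ) : ℂ) *
      mderiv p.2.1 f.toFun p.2.2, memℓp_infty (by
    refine ⟨seminorm d t s h f, ?_⟩
    rintro _ ⟨p, rfl⟩
    have hw := gsWeight_pos t s h.2 p.1 p.2.1
    change ‖_ * _‖ ≤ _
    rw [norm_mul, Complex.norm_real, Real.norm_eq_abs, abs_div, abs_of_pos hw, div_mul_eq_mul_div,
      div_le_iff₀ hw]
    exact le_seminorm h f _ _ _)⟩
  map_add' f g := by
    ext p
    change _ * mderiv p.2.1 (f + g).toFun p.2.2 = _ * mderiv p.2.1 f.toFun p.2.2 +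
      _ * mderiv p.2.1 g.toFun p.2.2
    rw [toFun_add, mderiv_add _ f.mem.1 g.mem.1, Pi.add_apply, mul_add]
  map_smul' c f := by
    ext p
    change _ * mderiv p.2.1 (c • f).toFun p.2.2 = c * (_ * mderiv p.2.1 f.toFun p.2.2)
    rw [toFun_smul, mderiv_smul _ _ f.mem.1, Pi.smul_apply, smul_eq_mul]
    ring

theorem toLp_apply (h : {h : ℝ // 0 < h}) (f : GelfandShilov d t s) (p : RatioIndex d) :
    toLp h f p = ((mpow p.2.2 p.1 / gsWeight t s h.1 p.1 p.2.1 : ℝ) : ℂ) *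
      mderiv p.2.1 f.toFun p.2.2 := rfl

theorem norm_toLp_apply (h : {h : ℝ // 0 < h}) (f : GelfandShilov d t s) (p : RatioIndex d) :
    ‖toLp h f p‖ = ratio h.1 f p := by
  have hw := gsWeight_pos t s h.2 p.1 p.2.1
  rw [toLp_apply, norm_mul, Complex.norm_real, Real.norm_eq_abs, abs_div, abs_of_pos hw,
    div_mul_eq_mul_div, ratio]

theorem norm_toLp (h : {h : ℝ // 0 < h}) (f : GelfandShilov d t s) :
    ‖toLp h f‖ = seminorm d t s h f := by
  refine le_antisymm (lp.norm_le_of_forall_le (apply_nonneg _ _) fun p => ?_)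
    (ciSup_le fun p => ?_)
  · rw [norm_toLp_apply]
    exact le_ciSup (bddAbove_ratio h.2 f) p
  · rw [← norm_toLp_apply]
    exact lp.norm_apply_le_norm (by simp) _ p

theorem continuous_toLp (h : {h : ℝ // 0 < h}) :
    Continuous (toLp h : GelfandShilov d t s →ₗ[ℂ] lp (fun _ : RatioIndex d => ℂ) ⊤) := by
  refine (withSeminorms d t s).continuous_normedSpace_rng _ _ ⟨{h}, 1, fun f => ?_⟩
  rw [one_smul, Finset.sup_singleton]
  exact (norm_toLp h f).le

theorem toLp_injective (h : {h : ℝ // 0 < h}) :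
    Function.Injective (toLp h : GelfandShilov d t s →ₗ[ℂ] lp (fun _ : RatioIndex d => ℂ) ⊤) := by
  intro f g hfg
  refine GelfandShilov.ext ?_
  funext x
  have h1 : toLp h f (0, 0, x) = toLp h g (0, 0, x) := by rw [hfg]
  have h2 : mderiv (0 : Fin d → ℕ) = id := by
    funext f
    unfold mderiv
    simp
  simpa [toLp_apply, mpow, gsWeight, mlen, mfact, h2] using h1

end GelfandShilov

-- Continuity gives a bound by finitely many norms; as the norms increase when `h` decreases, the
-- smallest `h` dominates them all.
open GelfandShilov in
theorem GelfandShilovDual.exists_bound {d : ℕ} {t s : ℝ} (u : GelfandShilovDual d t s) :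
    ∃ (h : {h : ℝ // 0 < h}) (C : ℝ), 0 ≤ C ∧ ∀ f, ‖u f‖ ≤ C * seminorm d t s h f := by
  obtain ⟨S, C, -, hC⟩ := Seminorm.bound_of_continuous (withSeminorms d t s)
    ((normSeminorm ℂ ℂ).comp u.toLinearMap) (continuous_norm.comp u.continuous)
  obtain ⟨k, hk⟩ : ∃ k : {h : ℝ // 0 < h}, S.sup (seminorm d t s) ≤ seminorm d t s k := by
    clear hC
    induction S using Finset.induction with
    | empty => exact ⟨⟨1, one_pos⟩, by simp⟩
    | insert h S _ ih =>
      obtain ⟨k, hk⟩ := ih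
      refine ⟨⟨min h.1 k.1, lt_min h.2 k.2⟩, ?_⟩
      rw [Finset.sup_insert]
      exact sup_le (seminorm_anti (min_le_left _ _)) (hk.trans (seminorm_anti (min_le_right _ _)))
  refine ⟨k, C, C.2, fun f => (hC f).trans ?_⟩
  exact mul_le_mul_of_nonneg_left (hk f) C.2

open GelfandShilov in
/-- Elements of `(Σ_t^s)'(ℝ^d)` factor through the embeddings into spaces of bounded functions. -/
theorem GelfandShilovDual.exists_extension {d : ℕ} {t s : ℝ} (u : GelfandShilovDual d t s) :
    ∃ (h : {h : ℝ // 0 < h}) (v : lp (fun _ : RatioIndex d => ℂ) ⊤ →L[ℂ] ℂ),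
      ∀ f, v (toLp h f) = u f := by
  obtain ⟨h, C, -, hC⟩ := u.exists_bound
  let e := LinearEquiv.ofInjective (toLp h : GelfandShilov d t s →ₗ[ℂ] _) (toLp_injective h)
  -- Since `toLp h` is injective and isometric for the norm that bounds `u`, the functional
  -- transports to a bounded one on its range, to which Hahn–Banach applies.
  let w : StrongDual ℂ (LinearMap.range (toLp h : GelfandShilov d t s →ₗ[ℂ] _)) :=
    (u.toLinearMap ∘ₗ e.symm.toLinearMap).mkContinuous C (by
      intro y
      obtain ⟨f, rfl⟩ := e.surjective y
      change ‖u (e.symm (e f))‖ ≤ C * ‖e f‖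
      rw [e.symm_apply_apply]
      refine (hC f).trans (le_of_eq ?_)
      rw [← norm_toLp h f]
      rfl)
  obtain ⟨v, hv, -⟩ := exists_extension_norm_eq _ w
  refine ⟨h, v, fun f => ?_⟩
  have h1 := hv (e f)
  change v (toLp h f) = u (e.symm (e f)) at h1
  rwa [e.symm_apply_apply] at h1

open MeasureTheory GelfandShilov in
/-- Elements of `(Σ_t^s)'(ℝ^d)` commute with integrals of continuous families. -/
theorem GelfandShilovDual.apply_eq_integral {d : ℕ} {t s : ℝ} (u : GelfandShilovDual d t s)
    {Φ : E d → GelfandShilov d t s} (hΦ : Continuous Φ)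
    (hint : ∀ h, Integrable fun w => seminorm d t s h (Φ w)) {q : GelfandShilov d t s}
    (hq : ∀ y, q.toFun y = ∫ w, (Φ w).toFun y) : u q = ∫ w, u (Φ w) := by
  obtain ⟨h, v, hv⟩ := u.exists_extension
  have hc : Continuous fun w => toLp h (Φ w) := (continuous_toLp h).comp hΦ
  have hi : Integrable fun w => toLp h (Φ w) :=
    (hint h).mono' hc.aestronglyMeasurable
      (Filter.Eventually.of_forall fun w => (norm_toLp h _).le)
  -- The coordinates with `α = 0` recover all derivatives, so these depend continuously on `w` along
  -- `Φ`, which supplies the measurability needed below.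
  have hmul : ∀ (β : Fin d → ℕ) (y : E d) (f : GelfandShilov d t s),
      mderiv β f.toFun y = ((gsWeight t s h.1 0 β : ℝ) : ℂ) * toLp h f (0, β, y) := by
    intro β y f
    have h0 : ((gsWeight t s h.1 0 β : ℝ) : ℂ) ≠ 0 := by
      exact_mod_cast (gsWeight_pos t s h.2 (0 : Fin d → ℕ) β).ne'
    have h1 : mpow y (0 : Fin d → ℕ) = 1 := by simp [mpow]
    rw [toLp_apply, h1]
    push_cast
    field_simp
  have hderiv : ∀ (β : Fin d → ℕ) (y : E d),
      mderiv β q.toFun y = ∫ w, mderiv β (Φ w).toFun y := by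
    intro β y
    rw [mderiv_eq_foldr]
    simp only [mderiv_eq_foldr]
    refine foldr_pderiv_integral (fun w => (Φ w).mem.1) q.mem.1 hq (fun l y => ?_) (fun l => ?_) _ y
    · simp only [foldr_eq_mderiv l (Φ _).mem.1, hmul]
      exact (continuous_const.mul
        ((lp.evalCLM ℂ (fun _ : RatioIndex d => ℂ) ⊤ _).continuous.comp hc)).aestronglyMeasurable
    · refine ⟨fun w => seminorm d t s h (Φ w) * gsWeight t s h.1 0 (fun j => l.count j),
        (hint h).mul_const _, fun w y => ?_⟩
      rw [foldr_eq_mderiv l (Φ w).mem.1]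
      simpa [mpow] using le_seminorm h (Φ w) 0 (fun j => l.count j) y
  -- Coordinate evaluations commute with the Bochner integral, so the vector identity reduces to the
  -- scalar identities `hderiv`.
  have hJ : toLp h q = ∫ w, toLp h (Φ w) := by
    ext p
    have h1 := (lp.evalCLM ℂ (fun _ : RatioIndex d => ℂ) ⊤ p).integral_comp_comm hi
    change ∫ w, toLp h (Φ w) p = (∫ w, toLp h (Φ w) : lp (fun _ : RatioIndex d => ℂ) ⊤) p at h1
    rw [← h1]
    simp only [toLp_apply]
    rw [integral_const_mul, hderiv]
  rw [← hv q, hJ, ← v.integral_comp_comm hi]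
  simp only [hv]

end GelfandShilovWF

namespace GelfandShilovWF

/-! ### The short-time Fourier transform at a fixed point -/

variable {d : ℕ} {t s : ℝ}

/-- For fixed `x` this exhibits `V_ψ u(x, ·)` as the Fourier transform of `u` multiplied by `conj
ψ(· - x)`. -/
theorem stft_eq (ht : 0 < t) (hs : 0 < s) (ψ : GelfandShilov d t s) (u : GelfandShilovDual d t s)
    (x ξ : E d) : stft ht hs ψ u x ξ = (((2 * Real.pi) ^ (-(d : ℝ) / 2) : ℝ) : ℂ) *
      u (((ψ.translate ht x).conj).modulate hs (-ξ)) := by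
  unfold stft
  congr 2
  refine GelfandShilov.ext ?_
  funext y
  change starRingEnd ℂ (Complex.exp _ * _) = Complex.exp _ * starRingEnd ℂ _
  rw [map_mul, ← Complex.exp_conj, map_mul, Complex.conj_I, Complex.conj_ofReal, inner_neg_right]
  congr 2
  push_cast
  ring

theorem exists_norm_stft_le (ht : 0 < t) (hs : 0 < s) (ψ : GelfandShilov d t s)
    (u : GelfandShilovDual d t s) (x : E d) : ∃ C r : ℝ, 0 ≤ C ∧ 0 ≤ r ∧ ∀ ξ : E d,
      ‖stft ht hs ψ u x ξ‖ ≤ C * Real.exp (r * ‖ξ‖ ^ (1 / s)) := by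
  obtain ⟨h, C, hC0, hC⟩ := u.exists_bound
  obtain ⟨k, r, hr, hk⟩ := GelfandShilov.seminorm_modulate_le (d := d) (t := t) hs h
  set f := (ψ.translate ht x).conj
  set c : ℂ := (((2 * Real.pi) ^ (-(d : ℝ) / 2) : ℝ) : ℂ)
  refine ⟨‖c‖ * (C * GelfandShilov.seminorm d t s k f), r, by positivity, hr, fun ξ => ?_⟩
  have h1 := hk (-ξ) f
  rw [norm_neg] at h1
  rw [stft_eq, norm_mul]
  calc ‖c‖ * ‖u (f.modulate hs (-ξ))‖
      ≤ ‖c‖ * (C * (Real.exp (r * ‖ξ‖ ^ (1 / s)) * GelfandShilov.seminorm d t s k f)) := by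
        gcongr
        exact (hC _).trans (by gcongr)
    _ = _ := by ring

/-- The open cone of vectors with a positive multiple at distance less than `ε` from `ξ₀`. -/
def coneAbout (ξ₀ : E d) (ε : ℝ) : Set (E d) := {ξ | ∃ l : ℝ, 0 < l ∧ ‖l • ξ - ξ₀‖ < ε}

theorem isOpen_coneAbout (ξ₀ : E d) (ε : ℝ) : IsOpen (coneAbout ξ₀ ε) := by
  have h1 : coneAbout ξ₀ ε = ⋃ l : Set.Ioi (0 : ℝ), {ξ : E d | ‖l.1 • ξ - ξ₀‖ < ε} := by
    ext ξ
    simp [coneAbout]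
  rw [h1]
  exact isOpen_iUnion fun l => isOpen_lt (by fun_prop) continuous_const

theorem smul_mem_coneAbout {ξ₀ : E d} {ε : ℝ} {l : ℝ} (hl : 0 < l) {ξ : E d}
    (hξ : ξ ∈ coneAbout ξ₀ ε) : l • ξ ∈ coneAbout ξ₀ ε := by
  obtain ⟨m, hm, h⟩ := hξ
  refine ⟨m / l, by positivity, ?_⟩
  rwa [smul_smul, div_mul_cancel₀ _ hl.ne']

theorem zero_notMem_coneAbout {ξ₀ : E d} {ε : ℝ} (hε : ε ≤ ‖ξ₀‖) : (0 : E d) ∉ coneAbout ξ₀ ε := by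
  rintro ⟨l, -, h⟩
  rw [smul_zero, zero_sub, norm_neg] at h
  linarith

theorem self_mem_coneAbout (ξ₀ : E d) {ε : ℝ} (hε : 0 < ε) : ξ₀ ∈ coneAbout ξ₀ ε :=
  ⟨1, one_pos, by simpa using hε⟩

theorem mul_norm_le_of_norm_sub_lt {ξ ξ₀ : E d} {ε l : ℝ} (hl : 0 < l) (hε : ε ≤ ‖ξ₀‖)
    (h : ‖l • ξ - ξ₀‖ < ε) : l * ‖ξ‖ ≤ 2 * ‖ξ₀‖ := by
  have h1 : ‖l • ξ‖ = l * ‖ξ‖ := by rw [norm_smul, Real.norm_of_nonneg hl.le]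
  have h2 := norm_sub_norm_le (l • ξ) ξ₀
  linarith

/-- Write `(x, ξ) = (m^t x', m^s ξ')` with `ξ' = l ξ` near `ξ₀` and `m = l^{-1/s}`. For large `m`
the point `x' = m^{-t} x` is close to `0` and the decay on `U` applies; for bounded `m` the vector
`ξ` is bounded and the growth estimate is enough. -/
theorem exists_cone_decay (ht : 0 < t) (hs : 0 < s) (ψ : GelfandShilov d t s)
    (u : GelfandShilovDual d t s) {ξ₀ : E d} (hξ₀ : ξ₀ ≠ 0)
    (hz : ((0 : E d), ξ₀) ∉ gsWaveFrontSet ht hs ψ u) (x : E d) :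
    ∃ ε : ℝ, 0 < ε ∧ ε ≤ ‖ξ₀‖ ∧ ∀ r : ℝ, 0 < r → ∃ C : ℝ, ∀ ξ ∈ coneAbout ξ₀ ε,
      Real.exp (r * ‖ξ‖ ^ (1 / s)) * ‖stft ht hs ψ u x ξ‖ ≤ C := by
  have hne : ((0 : E d), ξ₀) ≠ 0 := fun h => hξ₀ (congrArg Prod.snd h)
  simp only [gsWaveFrontSet, Set.mem_ofPred_eq, not_and, not_not] at hz
  obtain ⟨U, hU, -, hzU, hdec⟩ := hz hne
  obtain ⟨ε₁, hε₁, hball⟩ := Metric.isOpen_iff.mp hU _ hzU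
  have hn0 : 0 < ‖ξ₀‖ := norm_pos_iff.mpr hξ₀
  set ε := min ε₁ ‖ξ₀‖
  have hε : 0 < ε := lt_min hε₁ hn0
  refine ⟨ε, hε, min_le_right _ _, fun r hr => ?_⟩
  -- Since `‖l ξ‖ ≤ 2 ‖ξ₀‖`, one has `‖ξ‖^{1/s} ≤ a m`, so the rate `r a` in `m` gives the rate `r`
  -- in `‖ξ‖^{1/s}`.
  set a : ℝ := (2 * ‖ξ₀‖) ^ (1 / s)
  have ha : 0 < a := by positivity
  obtain ⟨C, hC⟩ := hdec (r * a) (by positivity)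
  obtain ⟨C₁, r₁, hC₁, hr₁, hV⟩ := exists_norm_stft_le ht hs ψ u x
  -- The threshold for `m` beyond which `m^{-t} ‖x‖ < ε`.
  set Λ : ℝ := (‖x‖ / ε) ^ (1 / t)
  refine ⟨max C (Real.exp (r * (Λ * a)) * (C₁ * Real.exp (r₁ * (Λ * a)))), ?_⟩
  rintro ξ ⟨l, hl, hlξ⟩
  set m : ℝ := (l⁻¹) ^ (1 / s) with hm
  have hm0 : 0 < m := by positivity
  have hms : m ^ s = l⁻¹ := by
    rw [hm, ← Real.rpow_mul (by positivity), one_div_mul_cancel hs.ne', Real.rpow_one]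
  have hξm : ‖ξ‖ ^ (1 / s) ≤ m * a := by
    rw [hm, ← Real.mul_rpow (by positivity) (by positivity)]
    have := mul_norm_le_of_norm_sub_lt hl (min_le_right _ _) hlξ
    refine Real.rpow_le_rpow (norm_nonneg _) ?_ (by positivity)
    rwa [inv_mul_eq_div, le_div_iff₀' hl]
  by_cases hx : (m ^ t)⁻¹ * ‖x‖ < ε
  · refine le_max_of_le_left ?_
    have hmem : ((m ^ t)⁻¹ • x, l • ξ) ∈ U := by
      refine hball ?_
      rw [Metric.mem_ball, Prod.dist_eq, max_lt_iff, dist_zero_right, dist_eq_norm, norm_smul,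
        Real.norm_of_nonneg (by positivity)]
      exact ⟨hx.trans_le (min_le_left _ _), hlξ.trans_le (min_le_left _ _)⟩
    have h1 := hC m hm0 _ hmem
    simp only at h1
    rw [hms, smul_smul, smul_smul, inv_mul_cancel₀ hl.ne', mul_inv_cancel₀ (by positivity),
      one_smul, one_smul] at h1
    refine le_trans ?_ h1
    refine mul_le_mul_of_nonneg_right (Real.exp_le_exp.mpr ?_) (norm_nonneg _)
    calc r * ‖ξ‖ ^ (1 / s) ≤ r * (m * a) := by gcongr
      _ = r * a * m := by ring
  · refine le_max_of_le_right ?_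
    have h1 : m ≤ Λ := by
      rw [not_lt, ← div_eq_inv_mul, le_div_comm₀ hε (by positivity)] at hx
      have h2 := Real.rpow_le_rpow (by positivity) hx (z := 1 / t) (by positivity)
      rwa [← Real.rpow_mul hm0.le, mul_one_div_cancel ht.ne', Real.rpow_one] at h2
    have h2 : ‖ξ‖ ^ (1 / s) ≤ Λ * a := hξm.trans (by gcongr)
    have h3 : ‖stft ht hs ψ u x ξ‖ ≤ C₁ * Real.exp (r₁ * (Λ * a)) :=
      (hV ξ).trans (by gcongr)
    gcongr

/-- Growth in all directions and decay in a cone give decay, in a smaller cone, of all translates,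
up to a factor depending on the translation. -/
theorem exists_translate_decay (hs : 1 ≤ s) {V : E d → ℂ} {ξ₀ : E d} (hξ₀ : ξ₀ ≠ 0) {ε : ℝ}
    (hε : 0 < ε) (hεξ : ε ≤ ‖ξ₀‖) {C₁ r₁ : ℝ} (hC₁ : 0 ≤ C₁) (hr₁ : 0 ≤ r₁)
    (hV : ∀ ξ, ‖V ξ‖ ≤ C₁ * Real.exp (r₁ * ‖ξ‖ ^ (1 / s)))
    (hdec : ∀ r : ℝ, 0 < r → ∃ C : ℝ, ∀ ξ ∈ coneAbout ξ₀ ε,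
      Real.exp (r * ‖ξ‖ ^ (1 / s)) * ‖V ξ‖ ≤ C) {r : ℝ} (hr : 0 < r) :
    ∃ C M : ℝ, 0 ≤ C ∧ 0 ≤ M ∧ ∀ ξ ∈ coneAbout ξ₀ (ε / 2), ∀ η : E d,
      Real.exp (r * ‖ξ‖ ^ (1 / s)) * ‖V (ξ - η)‖ ≤ C * Real.exp (M * ‖η‖ ^ (1 / s)) := by
  have hs0 : 0 < s := by linarith
  have hs1 : 1 / s ≤ 1 := by rw [div_le_one hs0]; exact hs
  have hn0 : 0 < ‖ξ₀‖ := norm_pos_iff.mpr hξ₀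
  -- If `‖η‖ ≤ δ ‖ξ‖`, then `l η` has norm at most `2 δ ‖ξ₀‖ = ε/2`, so `ξ - η` stays in the larger
  -- cone; also `δ ≤ 1/4` gives `‖ξ‖ ≤ 2 ‖ξ - η‖`.
  set δ : ℝ := ε / (4 * ‖ξ₀‖) with hδ
  have hδ0 : 0 < δ := by positivity
  have hδ1 : δ ≤ 1 / 4 := by rw [hδ, div_le_iff₀ (by positivity)]; linarith
  -- Twice the rate is needed because `‖ξ‖^{1/s} ≤ 2 ‖ξ - η‖^{1/s}`.
  obtain ⟨C, hC⟩ := hdec (2 * r) (by positivity)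
  set K : ℝ := (1 / δ) ^ (1 / s)
  have hK : 0 ≤ K := by positivity
  refine ⟨max C C₁, r * K + r₁ * (K + 1), le_max_of_le_right hC₁, by positivity, ?_⟩
  rintro ξ ⟨l, hl, hlξ⟩ η
  have hmax : 0 ≤ max C C₁ := le_max_of_le_right hC₁
  by_cases hη : ‖η‖ ≤ δ * ‖ξ‖
  · have h1 : ξ - η ∈ coneAbout ξ₀ ε := by
      refine ⟨l, hl, ?_⟩
      have h2 := mul_norm_le_of_norm_sub_lt hl (by linarith) hlξ
      have h3 : l * ‖η‖ ≤ ε / 2 := by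
        calc l * ‖η‖ ≤ l * (δ * ‖ξ‖) := by gcongr
          _ = δ * (l * ‖ξ‖) := by ring
          _ ≤ δ * (2 * ‖ξ₀‖) := by gcongr
          _ = ε / 2 := by rw [hδ]; field_simp; norm_num
      calc ‖l • (ξ - η) - ξ₀‖ = ‖(l • ξ - ξ₀) - l • η‖ := by rw [smul_sub]; congr 1; abel
        _ ≤ ‖l • ξ - ξ₀‖ + ‖l • η‖ := norm_sub_le _ _
        _ < ε / 2 + ε / 2 := by
            rw [norm_smul, Real.norm_of_nonneg hl.le]; linarith
        _ = ε := by ring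
    have h4 : ‖ξ‖ ≤ 2 * ‖ξ - η‖ := by
      have := norm_sub_norm_le ξ η
      nlinarith [norm_nonneg ξ]
    have h5 : ‖ξ‖ ^ (1 / s) ≤ 2 * ‖ξ - η‖ ^ (1 / s) := by
      calc ‖ξ‖ ^ (1 / s) ≤ (2 * ‖ξ - η‖) ^ (1 / s) := by gcongr
        _ = 2 ^ (1 / s) * ‖ξ - η‖ ^ (1 / s) := Real.mul_rpow zero_le_two (norm_nonneg _)
        _ ≤ 2 ^ (1 : ℝ) * ‖ξ - η‖ ^ (1 / s) := by gcongr; norm_num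
        _ = _ := by rw [Real.rpow_one]
    calc Real.exp (r * ‖ξ‖ ^ (1 / s)) * ‖V (ξ - η)‖
        ≤ Real.exp (2 * r * ‖ξ - η‖ ^ (1 / s)) * ‖V (ξ - η)‖ := by
          refine mul_le_mul_of_nonneg_right (Real.exp_le_exp.mpr ?_) (norm_nonneg _)
          nlinarith
      _ ≤ C := hC _ h1
      _ ≤ max C C₁ * 1 := by rw [mul_one]; exact le_max_left _ _
      _ ≤ _ := by
          gcongr
          exact Real.one_le_exp (by positivity)
  -- Here `‖ξ‖ < ‖η‖ / δ`: both the weight and the growth of `V` are bounded by exponentials in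
  -- `‖η‖^{1/s}`, whose rates add up to `M`.
  · have h1 : ‖ξ‖ ^ (1 / s) ≤ K * ‖η‖ ^ (1 / s) := by
      rw [← Real.mul_rpow (by positivity) (norm_nonneg _)]
      refine Real.rpow_le_rpow (norm_nonneg _) ?_ (by positivity)
      rw [one_div, inv_mul_eq_div, le_div_iff₀' hδ0]
      exact (not_le.mp hη).le
    have h2 : ‖ξ - η‖ ^ (1 / s) ≤ (K + 1) * ‖η‖ ^ (1 / s) := by
      calc ‖ξ - η‖ ^ (1 / s) ≤ (‖ξ‖ + ‖η‖) ^ (1 / s) := by gcongr; exact norm_sub_le _ _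
        _ ≤ ‖ξ‖ ^ (1 / s) + ‖η‖ ^ (1 / s) :=
          Real.rpow_add_le_add_rpow (norm_nonneg _) (norm_nonneg _) (by positivity) hs1
        _ ≤ _ := by linarith
    calc Real.exp (r * ‖ξ‖ ^ (1 / s)) * ‖V (ξ - η)‖
        ≤ Real.exp (r * (K * ‖η‖ ^ (1 / s))) *
          (C₁ * Real.exp (r₁ * ((K + 1) * ‖η‖ ^ (1 / s)))) := by
          gcongr
          exact (hV _).trans (by gcongr)
      _ = C₁ * Real.exp ((r * K + r₁ * (K + 1)) * ‖η‖ ^ (1 / s)) := by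
          rw [mul_left_comm, ← Real.exp_add]; congr 2; ring
      _ ≤ _ := by gcongr; exact le_max_right _ _

/-! ### Localization by the product of a window and a cut-off function -/

open FourierTransform MeasureTheory

theorem continuous_fourier {g : E d → ℂ} (hg : Integrable g) : Continuous (𝓕 g) :=
  VectorFourier.fourierIntegral_continuous Real.continuous_fourierChar
    (by exact continuous_inner) hg

theorem integrable_norm_fourier_mul_exp (hs : 1 ≤ s) {g : E d → ℂ} (hg : IsUniformGevrey s g)
    (hgc : HasCompactSupport g) (M : ℝ) :
    Integrable fun w : E d => ‖𝓕 g w‖ * Real.exp (M * ‖w‖ ^ (1 / s)) := by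
  have hs0 : 0 < s := by linarith
  obtain ⟨ρ, hρ⟩ := exists_integrable_exp_neg_norm_rpow d hs
  -- The rate `ρ + M` cancels the growth `M` and leaves the integrable `exp(-ρ ‖w‖^{1/s})`.
  obtain ⟨C, hC0, hC⟩ := norm_fourier_le hs0 hg hgc (ρ + M)
  have hgi : Integrable g := hg.1.continuous.integrable_of_hasCompactSupport hgc
  have hc : Continuous fun w : E d => ‖w‖ ^ (1 / s) :=
    continuous_norm.rpow_const fun _ => Or.inr (by positivity)
  refine (hρ.const_mul C).mono' ?_ (Filter.Eventually.of_forall fun w => ?_)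
  · exact ((continuous_fourier hgi).norm.mul
      (Real.continuous_exp.comp (continuous_const.mul hc))).aestronglyMeasurable
  · rw [Real.norm_of_nonneg (by positivity)]
    calc ‖𝓕 g w‖ * Real.exp (M * ‖w‖ ^ (1 / s))
        ≤ C * Real.exp (-((ρ + M) * ‖w‖ ^ (1 / s))) * Real.exp (M * ‖w‖ ^ (1 / s)) := by
          gcongr; exact hC w
      _ = _ := by rw [mul_assoc, ← Real.exp_add]; congr 2; ring

theorem norm_two_pi_smul_rpow (w : E d) : ‖(2 * Real.pi) • w‖ ^ (1 / s) =
    (2 * Real.pi) ^ (1 / s) * ‖w‖ ^ (1 / s) := by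
  rw [norm_smul, Real.norm_of_nonneg Real.two_pi_pos.le,
    Real.mul_rpow Real.two_pi_pos.le (norm_nonneg _)]

/-- Fourier inversion writes `g` as a superposition of characters, so `q` is the integral of the
modulations of `p` weighted by `𝓕 g`. Their norms grow at most like `exp(r ‖·‖^{1/s})`, which `𝓕 g`
outweighs. The factor `2π` reflects the normalization of `𝓕`. -/
theorem apply_modulate_mul_eq_integral (ht : 0 < t) (hs : 0 < s) (hs1 : 1 ≤ s)
    (u : GelfandShilovDual d t s) (p : GelfandShilov d t s) {g : E d → ℂ}
    (hg : IsUniformGevrey s g) (hgc : HasCompactSupport g) (ξ : E d) {q : GelfandShilov d t s}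
    (hq : ∀ y, q.toFun y = Complex.exp (Complex.I * ((inner ℝ y (-ξ) : ℝ) : ℂ)) *
      (p.toFun y * g y)) :
    u q = ∫ w, 𝓕 g w * u (p.modulate hs (-(ξ - (2 * Real.pi) • w))) := by
  have hgi : Integrable g := hg.1.continuous.integrable_of_hasCompactSupport hgc
  have hFc : Continuous (𝓕 g) := continuous_fourier hgi
  have hFi : Integrable (𝓕 g) := by
    have := integrable_norm_fourier_mul_exp hs1 hg hgc 0
    simp only [zero_mul, Real.exp_zero, mul_one] at this
    exact (integrable_norm_iff hFc.aestronglyMeasurable).mp this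
  have := (GelfandShilov.withSeminorms d t s).continuousSMul
  have hmc : Continuous fun w : E d => p.modulate hs (-(ξ - (2 * Real.pi) • w)) :=
    (GelfandShilov.continuous_modulate ht hs p).comp (by fun_prop)
  have hΦ : Continuous fun w => 𝓕 g w • p.modulate hs (-(ξ - (2 * Real.pi) • w)) :=
    hFc.smul hmc
  have h1 := u.apply_eq_integral hΦ (q := q) (fun h => ?_) (fun y => ?_)
  · simpa only [map_smul, smul_eq_mul] using h1
  · obtain ⟨k, r, hr, hk⟩ := GelfandShilov.seminorm_modulate_le (d := d) (t := t) hs h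
    have h2 := (integrable_norm_fourier_mul_exp hs1 hg hgc
      (r * (2 * Real.pi) ^ (1 / s))).mul_const
      (Real.exp (r * ‖ξ‖ ^ (1 / s)) * GelfandShilov.seminorm d t s k p)
    refine h2.mono' ?_ (Filter.Eventually.of_forall fun w => ?_)
    · simp only [← GelfandShilov.norm_toLp]
      exact ((GelfandShilov.continuous_toLp h).comp hΦ).norm.aestronglyMeasurable
    · rw [Real.norm_of_nonneg (apply_nonneg _ _), map_smul_eq_mul]
      have h3 := hk (-(ξ - (2 * Real.pi) • w)) p
      have h4 : ‖-(ξ - (2 * Real.pi) • w)‖ ^ (1 / s) ≤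
          ‖ξ‖ ^ (1 / s) + (2 * Real.pi) ^ (1 / s) * ‖w‖ ^ (1 / s) := by
        rw [norm_neg, ← norm_two_pi_smul_rpow]
        refine le_trans ?_ (Real.rpow_add_le_add_rpow (norm_nonneg _) (norm_nonneg _)
          (by positivity) (by rw [div_le_one hs]; exact hs1))
        gcongr
        exact norm_sub_le _ _
      calc ‖𝓕 g w‖ * GelfandShilov.seminorm d t s h (p.modulate hs (-(ξ - (2 * Real.pi) • w)))
          ≤ ‖𝓕 g w‖ * (Real.exp (r * (‖ξ‖ ^ (1 / s) + (2 * Real.pi) ^ (1 / s) * ‖w‖ ^ (1 / s))) *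
            GelfandShilov.seminorm d t s k p) := by
            gcongr
            exact h3.trans (by gcongr)
        _ = _ := by rw [mul_add, Real.exp_add]; ring_nf
  · have h2 := congrFun (hg.1.continuous.fourierInv_fourier_eq hgi hFi) y
    rw [Real.fourierInv_eq'] at h2
    rw [hq, ← h2, ← integral_const_mul, ← integral_const_mul]
    refine integral_congr_ae (Filter.Eventually.of_forall fun w => ?_)
    have h3 : Complex.exp (Complex.I * ((inner ℝ y (-(ξ - (2 * Real.pi) • w)) : ℝ) : ℂ)) =
        Complex.exp (Complex.I * ((inner ℝ y (-ξ) : ℝ) : ℂ)) *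
        Complex.exp (((2 * Real.pi * inner ℝ w y : ℝ) : ℂ) * Complex.I) := by
      rw [← Complex.exp_add, neg_sub, inner_sub_right, inner_smul_right, inner_neg_right,
        real_inner_comm y w]
      congr 1
      push_cast
      ring
    change _ = 𝓕 g w * (Complex.exp _ * p.toFun y)
    rw [h3]
    simp only [smul_eq_mul]
    ring

/-- The convolution theorem for the product of `u · conj ψ(· - x)` with `g`. -/
theorem localFourier_eq_integral (ht : 0 < t) (hs : 0 < s) (hs1 : 1 ≤ s)
    (ψ : GelfandShilov d t s) (u : GelfandShilovDual d t s) (x : E d) {g : E d → ℂ}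
    (hg : IsUniformGevrey s g) (hgc : HasCompactSupport g) (χ : gevreyC d s)
    (hχ : ∀ y, χ.1 y = ((ψ.translate ht x).conj).toFun y * g y) (ξ : E d) :
    localFourier hs (u.toGevrey ht) χ ξ =
      ∫ w, 𝓕 g w * stft ht hs ψ u x (ξ - (2 * Real.pi) • w) := by
  have h1 := apply_modulate_mul_eq_integral ht hs hs1 u ((ψ.translate ht x).conj) hg hgc ξ
    (q := gevreyInclusion d s ht (gevreyModulate hs (-ξ) χ)) (fun y => by rw [← hχ]; rfl)
  change _ * u (gevreyInclusion d s ht (gevreyModulate hs (-ξ) χ)) = _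
  rw [h1, ← integral_const_mul]
  refine integral_congr_ae (Filter.Eventually.of_forall fun w => ?_)
  simp only [stft_eq]
  ring

/-- A direction `ξ₀` with `(0, ξ₀) ∉ WF^{t,s}(u)` is not in `WF_s(u)` over any point. -/
theorem notMem_gevreyWaveFrontSet (ht : 0 < t) (hs : 0 < s) (hs1 : 1 < s)
    {ψ : GelfandShilov d t s} (hψ : ψ ≠ 0) (u : GelfandShilovDual d t s) {ξ₀ : E d}
    (hξ₀ : ξ₀ ≠ 0) (hz : ((0 : E d), ξ₀) ∉ gsWaveFrontSet ht hs ψ u) (x₀ : E d) :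
    (x₀, ξ₀) ∉ gevreyWaveFrontSet hs (u.toGevrey ht) := by
  obtain ⟨y₀, hy₀⟩ : ∃ y₀, ψ.toFun y₀ ≠ 0 := by
    by_contra! h
    exact hψ (GelfandShilov.ext (funext h))
  -- The translation moves a point where `ψ` does not vanish to `x₀`, so that dividing by `p(x₀)
  -- g₀(x₀)` can normalize `χ(x₀) = 1`.
  set x := x₀ - y₀ with hx
  set p := (ψ.translate ht x).conj with hp
  have hpx : p.toFun x₀ ≠ 0 := by
    change starRingEnd ℂ (ψ.toFun (x₀ - x)) ≠ 0
    rw [hx, sub_sub_cancel]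
    exact (map_ne_zero _).mpr hy₀
  obtain ⟨g₀, hg₀, hg₀c, hg₀x⟩ := exists_isUniformGevrey_bump d hs1 x₀
  set g : E d → ℂ := fun y => (p.toFun x₀ * g₀ x₀)⁻¹ * g₀ y
  have hg : IsUniformGevrey s g := (IsUniformGevrey.const _).mul hs.le hg₀
  have hgc : HasCompactSupport g := hg₀c.mul_left
  let χ : gevreyC d s := ⟨fun y => p.toFun y * g y,
    ((p.mem.isUniformGevrey hs.le).mul hs.le hg).isGevrey hs.le, hgc.mul_left⟩
  have hχ : χ.1 x₀ = 1 := by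
    change p.toFun x₀ * ((p.toFun x₀ * g₀ x₀)⁻¹ * g₀ x₀) = 1
    field_simp
  obtain ⟨ε, hε, hεξ, hdec⟩ := exists_cone_decay ht hs ψ u hξ₀ hz x
  obtain ⟨C₁, r₁, hC₁, hr₁, hV⟩ := exists_norm_stft_le ht hs ψ u x
  rintro ⟨-, h⟩
  refine h ⟨χ, hχ, coneAbout ξ₀ (ε / 2), isOpen_coneAbout _ _,
    fun l hl ξ hξ => smul_mem_coneAbout hl hξ, zero_notMem_coneAbout (by linarith),
    self_mem_coneAbout _ (by positivity), fun r hr => ?_⟩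
  obtain ⟨C, M, hC0, hM0, hCM⟩ := exists_translate_decay hs1.le hξ₀ hε hεξ hC₁ hr₁ hV hdec hr
  -- This majorant does not depend on `ξ`: the exponential loss in `η = 2π w` is integrable against
  -- `𝓕 g`.
  have hint := (integrable_norm_fourier_mul_exp hs1.le hg hgc
    (M * (2 * Real.pi) ^ (1 / s))).const_mul C
  refine ⟨∫ w, C * (‖𝓕 g w‖ * Real.exp (M * (2 * Real.pi) ^ (1 / s) * ‖w‖ ^ (1 / s))),
    fun ξ hξ => ?_⟩
  rw [localFourier_eq_integral ht hs hs1.le ψ u x hg hgc χ (fun _ => rfl),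
    ← Real.norm_of_nonneg (Real.exp_pos (r * ‖ξ‖ ^ (1 / s))).le, ← Complex.norm_real, ← norm_mul,
    ← integral_const_mul]
  refine norm_integral_le_of_norm_le hint (Filter.Eventually.of_forall fun w => ?_)
  have h1 := hCM ξ hξ ((2 * Real.pi) • w)
  rw [norm_two_pi_smul_rpow] at h1
  rw [norm_mul, norm_mul, Complex.norm_real, Real.norm_of_nonneg (Real.exp_pos _).le]
  calc _ = ‖𝓕 g w‖ * (Real.exp (r * ‖ξ‖ ^ (1 / s)) *
        ‖stft ht hs ψ u x (ξ - (2 * Real.pi) • w)‖) := by ring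
    _ ≤ ‖𝓕 g w‖ * (C * Real.exp (M * ((2 * Real.pi) ^ (1 / s) * ‖w‖ ^ (1 / s)))) := by gcongr
    _ = _ := by rw [mul_assoc M]; ring

end GelfandShilovWF

/-- If `t ≥ s > 1` and `u ∈ (Σ_t^s)'(ℝ^d)`, then `{0} × π₂ WF_s(u) ⊆ WF^{t,s}(u)`, the right-hand
side being computed with an arbitrary window `ψ ∈ Σ_t^s(ℝ^d) ∖ 0`. -/
theorem proposition5p1 (d : ℕ) (t s : ℝ) (ht : 0 < t) (hs : 0 < s) (hs1 : 1 < s) (hst : s ≤ t)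
    (ψ : GelfandShilovWF.GelfandShilov d t s) (hψ : ψ ≠ 0)
    (u : GelfandShilovWF.GelfandShilovDual d t s) :
    ({0} : Set (GelfandShilovWF.E d)) ×ˢ
        (Prod.snd '' GelfandShilovWF.gevreyWaveFrontSet hs (u.toGevrey ht)) ⊆
      GelfandShilovWF.gsWaveFrontSet ht hs ψ u := by
  rintro ⟨x, ξ⟩ ⟨hx, ⟨⟨x₀, ξ'⟩, hmem, hξ⟩⟩
  obtain rfl : x = 0 := hx
  obtain rfl : ξ' = ξ := hξ
  by_contra hz
  exact GelfandShilovWF.notMem_gevreyWaveFrontSet ht hs hs1 hψ u hmem.1 hz x₀ hmem
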